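/- A graph $\Gamma$ consists of a set $V(\Gamma)$ of vertices, a set $\vec E(\Gamma)$ of directed edges, a fixed-point-free involution $e\mapsto e^{-1}$ of $\vec E(\Gamma)$ and a terminus map $\tau:\vec E(\Gamma)\to V(\Gamma)$ (so loops and multiple edges are allowed); the edge $e$ runs from $\tau(e^{-1})$ to $\tau(e)$. An isomorphism of graphs is a pair of bijections, on vertices and on directed edges, that commutes with the involutions and the terminus maps. $\Gamma$ is vertex transitive if its automorphism group acts transitively on $V(\Gamma)$, and countable if $V(\Gamma)$ is countable. A partite presentation $P=\langle X\mid \mathcal U\mid\mathcal I\mid\phi\mid\mathcal R\rangle$ consists of a nonempty set $X$ of vertex classes; a set of generators $\mathcal S=\mathcal U\sqcup\mathcal I$, with the associated group $MF_P=\langle \mathcal S\mid s^2,\ s\in\mathcal I\rangle$; a map $\phi:\mathcal S\to \mathrm{Sym}(X)$ such that $\phi(s)$ is a fixed-point-free involution for each $s\in\mathcal I$ and such that the right action of $MF_P$ on $X$ given by $x\cdot s_1\cdots s_n=\phi(s_n)\circ\cdots\circ\phi(s_1)(x)$ (where $s_i\in\mathcal S\cup\mathcal S^{-1}$ and $\phi(s^{-1})=\phi(s)^{-1}$)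 is transitive; and, for each $x\in X$, a set of relators $\mathcal R_x\subseteq \mathrm{Stab}(MF_P,x)$. The presentation graph $C(P)$ has vertex set $X$ and, for each $x\in X$ and each $s\in\mathcal U\cup\mathcal U^{-1}\cup\mathcal I$, one directed edge of colour $s$ from $x$ to $\phi(s)(x)$, whose inverse is the edge of colour $s^{-1}$ from $\phi(s)(x)$ to $x$ (with $s^{-1}=s$ for $s\in\mathcal I$). The partite presentation complex $\mathcal C(P)$ is the 2-complex obtained from $C(P)$ by gluing, for each $x\in X$ and $r\in\mathcal R_x$, a 2-cell along the closed walk that starts at $x$ and follows the edges coloured by the successive letters of the reduced word of $r$. The partite Cayley graph $\mathrm{Sp}(P)$ is the 1-skeleton of the universal cover of $\mathcal C(P)$. Theorem. Every countable, connected, vertex-transitive graph $\Gamma$ has a partite presentation, that is, $\Gamma$ is isomorphic to $\mathrm{Sp}(P)$ for some partite presentation $P$. -/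

import Mathlib

universe u

namespace Partite

/-! ### Graphs -/

/-- A graph in the sense of Gersten: a set of vertices, a set of directed edges, a fixed-point-free
involution `e ↦ e⁻¹` on the directed edges, and a terminus map. Multiple edges and loops are
allowed. -/
structure MGraph : Type (u + 1) where
  V : Type u
  E : Type u
  inv : E → E
  inv_inv : ∀ e, inv (inv e) = e
  inv_ne : ∀ e, inv e ≠ e
  term : E → V

namespace MGraph

/-- The initial vertex of a directed edge. -/
def init (G : MGraph.{u}) (e : G.E) : G.V := G.term (G.inv e)

/-- `G.IsWalk x l`: the directed edges in the list `l` are the consecutive edges of a walk that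
starts at `x`. -/
def IsWalk (G : MGraph.{u}) : G.V → List G.E → Prop
  | _, [] => True
  | x, e :: l => G.init e = x ∧ G.IsWalk (G.term e) l

/-- The last vertex of the walk from `x` along the edges `l`. -/
def endpoint (G : MGraph.{u}) : G.V → List G.E → G.V
  | x, [] => x
  | _, e :: l => G.endpoint (G.term e) l

/-- A graph is connected if it is nonempty and any two vertices are joined by a walk. -/
def Connected (G : MGraph.{u}) : Prop :=
  Nonempty G.V ∧ ∀ x y : G.V, ∃ l, G.IsWalk x l ∧ G.endpoint x l = y

/-- Maps of graphs. -/
structure Hom (G H : MGraph.{u}) where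
  onV : G.V → H.V
  onE : G.E → H.E
  map_inv : ∀ e, onE (G.inv e) = H.inv (onE e)
  map_term : ∀ e, onV (G.term e) = H.term (onE e)

/-- Isomorphisms of graphs: maps of graphs that are bijective on vertices and on directed edges. -/
structure Iso (G H : MGraph.{u}) extends Hom G H where
  bijective_onV : Function.Bijective onV
  bijective_onE : Function.Bijective onE

/-- The automorphism group acts transitively on the vertices. -/
def VertexTransitive (G : MGraph.{u}) : Prop :=
  ∀ x y : G.V, ∃ f : Iso G G, f.onV x = y

theorem isWalk_append (G : MGraph.{u}) (x : G.V) (p q : List G.E) :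
    G.IsWalk x (p ++ q) ↔ G.IsWalk x p ∧ G.IsWalk (G.endpoint x p) q := by
  induction p generalizing x with
  | nil => simp [IsWalk, endpoint]
  | cons e p ih => simp [IsWalk, endpoint, ih, and_assoc]

theorem endpoint_append (G : MGraph.{u}) (x : G.V) (p q : List G.E) :
    G.endpoint x (p ++ q) = G.endpoint (G.endpoint x p) q := by
  induction p generalizing x with
  | nil => rfl
  | cons e p ih => simp [endpoint, ih]

end MGraph

/-! ### Two-dimensional complexes, homotopy of walks, universal covers -/

/-- A (combinatorial) 2-complex: a graph, its 1-skeleton, together with a set of 2-cells; the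
boundary of a 2-cell `f` is glued along the closed walk `bdry f` starting and ending at
`base f`. -/
structure TwoComplex : Type (u + 1) where
  skeleton : MGraph.{u}
  F : Type u
  base : F → skeleton.V
  bdry : F → List skeleton.E
  isWalk_bdry : ∀ f, skeleton.IsWalk (base f) (bdry f)
  endpoint_bdry : ∀ f, skeleton.endpoint (base f) (bdry f) = base f

namespace TwoComplex

/-- The walks in the 1-skeleton starting at `x`. -/
abbrev WalkFrom (C : TwoComplex.{u}) (x : C.skeleton.V) : Type u :=
  {l : List C.skeleton.E // C.skeleton.IsWalk x l}

/-- Elementary homotopies of walks starting at `x`: inserting a pair `e e⁻¹`, or inserting the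
boundary of a 2-cell. -/
inductive Step (C : TwoComplex.{u}) (x : C.skeleton.V) :
    List C.skeleton.E → List C.skeleton.E → Prop
  | backtrack (p q : List C.skeleton.E) (e : C.skeleton.E)
      (h : C.skeleton.init e = C.skeleton.endpoint x p) :
      Step C x (p ++ q) (p ++ ([e, C.skeleton.inv e] ++ q))
  | cell (p q : List C.skeleton.E) (f : C.F)
      (h : C.base f = C.skeleton.endpoint x p) :
      Step C x (p ++ q) (p ++ (C.bdry f ++ q))

/-- Homotopy relative to the endpoints of walks starting at `x`: the equivalence relation generated
by the elementary homotopies. -/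
def homotopy (C : TwoComplex.{u}) (x : C.skeleton.V) : Setoid (C.WalkFrom x) :=
  Relation.EqvGen.setoid fun p q => C.Step x p.1 q.1

/-- A 2-complex is simply connected if it is connected and each closed walk is homotopic to the
trivial walk. -/
def SimplyConnected (C : TwoComplex.{u}) : Prop :=
  C.skeleton.Connected ∧
    ∀ (x : C.skeleton.V) (p : C.WalkFrom x), C.skeleton.endpoint x p.1 = x →
      C.homotopy x p ⟨[], trivial⟩

/-- Cellular maps of 2-complexes. -/
structure Hom (D C : TwoComplex.{u}) extends MGraph.Hom D.skeleton C.skeleton where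
  onF : D.F → C.F
  map_base : ∀ f, onV (D.base f) = C.base (onF f)
  map_bdry : ∀ f, (D.bdry f).map onE = C.bdry (onF f)

/-- A cellular map is a covering map if it is surjective on vertices and, at each vertex `v` of the
source, it is a bijection from the directed edges leaving `v`, and from the 2-cells based at `v`,
to those at the image of `v`. -/
structure Hom.IsCovering {D C : TwoComplex.{u}} (π : Hom D C) : Prop where
  surjective : Function.Surjective π.onV
  edges : ∀ v : D.skeleton.V, Set.BijOn π.onE {e | D.skeleton.init e = v}
    {e | C.skeleton.init e = π.onV v}
  cells : ∀ v : D.skeleton.V, Set.BijOn π.onF {f | D.base f = v} {f | C.base f = π.onV v}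

theorem Step.endpoint_eq {C : TwoComplex.{u}} {x : C.skeleton.V} {p q : List C.skeleton.E}
    (h : C.Step x p q) : C.skeleton.endpoint x p = C.skeleton.endpoint x q := by
  cases h with
  | backtrack p q e h =>
    simp only [MGraph.endpoint_append, MGraph.endpoint]
    rw [← h]; rfl
  | cell p q f h =>
    simp only [MGraph.endpoint_append]
    rw [← h, C.endpoint_bdry]

theorem Step.append {C : TwoComplex.{u}} {x : C.skeleton.V} {p q : List C.skeleton.E}
    (h : C.Step x p q) (r : List C.skeleton.E) : C.Step x (p ++ r) (q ++ r) := by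
  cases h with
  | backtrack p q e h => simpa using Step.backtrack p (q ++ r) e h
  | cell p q f h => simpa using Step.cell p (q ++ r) f h

/-- The vertices of the universal cover: homotopy classes of walks starting at the base
vertex `b`. -/
abbrev CoverV (C : TwoComplex.{u}) (b : C.skeleton.V) : Type u :=
  Quotient (C.homotopy b)

/-- The projection of the universal cover on vertices: the endpoint of a homotopy class. -/
def projV (C : TwoComplex.{u}) (b : C.skeleton.V) : C.CoverV b → C.skeleton.V :=
  Quotient.lift (fun p => C.skeleton.endpoint b p.1) fun p q h => by
    induction h with
    | rel _ _ h => exact h.endpoint_eq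
    | refl => rfl
    | symm _ _ _ ih => exact ih.symm
    | trans _ _ _ _ _ ih₁ ih₂ => exact ih₁.trans ih₂

theorem homotopy_append (C : TwoComplex.{u}) {b : C.skeleton.V} {p q : C.WalkFrom b}
    (h : C.homotopy b p q) (r : List C.skeleton.E)
    (hp : C.skeleton.IsWalk b (p.1 ++ r)) (hq : C.skeleton.IsWalk b (q.1 ++ r)) :
    C.homotopy b ⟨p.1 ++ r, hp⟩ ⟨q.1 ++ r, hq⟩ := by
  have key : ∀ p q : C.WalkFrom b, C.homotopy b p q →
      C.skeleton.endpoint b p.1 = C.skeleton.endpoint b q.1 := fun p q h =>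
    congrArg (C.projV b) (Quotient.sound (s := C.homotopy b) h)
  induction h with
  | rel _ _ h => exact Relation.EqvGen.rel _ _ (h.append r)
  | refl => exact Relation.EqvGen.refl _
  | symm _ _ _ ih => exact Relation.EqvGen.symm _ _ (ih hq hp)
  | trans p q s h₁ _ ih₁ ih₂ =>
    have hm : C.skeleton.IsWalk b (q.1 ++ r) := by
      rw [MGraph.isWalk_append] at hp ⊢
      exact ⟨q.2, key p q h₁ ▸ hp.2⟩
    exact Relation.EqvGen.trans _ _ _ (ih₁ hp hm) (ih₂ hm hq)

/-- Extending a homotopy class `[p]` of walks by a walk `r` that starts at the endpoint of `p`. -/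
def extend (C : TwoComplex.{u}) (b : C.skeleton.V) (v : C.CoverV b) (r : List C.skeleton.E)
    (h : C.skeleton.IsWalk (C.projV b v) r) : C.CoverV b :=
  Quotient.hrecOn (motive := fun v => C.skeleton.IsWalk (C.projV b v) r → C.CoverV b) v
    (fun p h => Quotient.mk (C.homotopy b)
      ⟨p.1 ++ r, (C.skeleton.isWalk_append b p.1 r).2 ⟨p.2, h⟩⟩)
    (fun p q hpq => by
      have e : C.projV b (Quotient.mk (C.homotopy b) p) = C.projV b (Quotient.mk (C.homotopy b) q) :=
        congrArg (C.projV b) (Quotient.sound (s := C.homotopy b) hpq)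
      refine Function.hfunext (by rw [e]) fun h₁ h₂ _ => heq_of_eq ?_
      exact Quotient.sound (s := C.homotopy b) (C.homotopy_append hpq r _ _))
    h

theorem extend_mk (C : TwoComplex.{u}) (b : C.skeleton.V) (p : C.WalkFrom b)
    (r : List C.skeleton.E)
    (h : C.skeleton.IsWalk (C.projV b (Quotient.mk (C.homotopy b) p)) r) :
    C.extend b (Quotient.mk (C.homotopy b) p) r h = Quotient.mk (C.homotopy b)
      ⟨p.1 ++ r, (C.skeleton.isWalk_append b p.1 r).2 ⟨p.2, h⟩⟩ := rfl

theorem projV_extend (C : TwoComplex.{u}) (b : C.skeleton.V) (v : C.CoverV b)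
    (r : List C.skeleton.E) (h : C.skeleton.IsWalk (C.projV b v) r) :
    C.projV b (C.extend b v r h) = C.skeleton.endpoint (C.projV b v) r := by
  induction v using Quotient.inductionOn with
  | _ p => exact C.skeleton.endpoint_append b p.1 r

/-- The directed edges of the universal cover: a vertex of the universal cover together with a
directed edge of `C` leaving its projection. -/
abbrev CoverE (C : TwoComplex.{u}) (b : C.skeleton.V) : Type u :=
  {d : C.CoverV b × C.skeleton.E // C.skeleton.init d.2 = C.projV b d.1}

/-- The terminus of the lift of `e` at `[p]` is `[p e]`. -/
def coverTerm (C : TwoComplex.{u}) (b : C.skeleton.V) (d : C.CoverE b) : C.CoverV b :=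
  C.extend b d.1.1 [d.1.2] ⟨d.2, trivial⟩

theorem projV_coverTerm (C : TwoComplex.{u}) (b : C.skeleton.V) (d : C.CoverE b) :
    C.projV b (C.coverTerm b d) = C.skeleton.term d.1.2 :=
  C.projV_extend b _ _ _

/-- The inverse of the lift of `e` at `[p]` is the lift of `e⁻¹` at `[p e]`. -/
def coverInv (C : TwoComplex.{u}) (b : C.skeleton.V) (d : C.CoverE b) : C.CoverE b :=
  ⟨(C.coverTerm b d, C.skeleton.inv d.1.2), by
    rw [projV_coverTerm, MGraph.init, C.skeleton.inv_inv]⟩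

theorem coverTerm_coverInv (C : TwoComplex.{u}) (b : C.skeleton.V) (d : C.CoverE b) :
    C.coverTerm b (C.coverInv b d) = d.1.1 := by
  obtain ⟨⟨v, e⟩, h⟩ := d
  induction v using Quotient.inductionOn with
  | _ p =>
    refine Quotient.sound (s := C.homotopy b) (Relation.EqvGen.symm _ _ ?_)
    refine Relation.EqvGen.rel _ _ ?_
    have := Step.backtrack (C := C) (x := b) p.1 [] e h
    simpa [coverInv] using this

/-- The 1-skeleton of the universal cover. -/
abbrev coverGraph (C : TwoComplex.{u}) (b : C.skeleton.V) : MGraph.{u} where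
  V := C.CoverV b
  E := C.CoverE b
  inv := C.coverInv b
  inv_inv d := Subtype.ext (Prod.ext (C.coverTerm_coverInv b d) (C.skeleton.inv_inv d.1.2))
  inv_ne d h := C.skeleton.inv_ne d.1.2 (congrArg (fun d => d.1.2) h)
  term := C.coverTerm b

/-- The lift, starting at the vertex `v` of the universal cover, of a walk in `C`. -/
def lift (C : TwoComplex.{u}) (b : C.skeleton.V) : (v : C.CoverV b) → (r : List C.skeleton.E) →
    C.skeleton.IsWalk (C.projV b v) r → List (C.CoverE b)
  | _, [], _ => []
  | v, e :: r, h => ⟨(v, e), h.1⟩ :: C.lift b (C.coverTerm b ⟨(v, e), h.1⟩) r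
      ((C.projV_coverTerm b ⟨(v, e), h.1⟩).symm ▸ h.2)

theorem isWalk_lift (C : TwoComplex.{u}) (b : C.skeleton.V) (v : C.CoverV b)
    (r : List C.skeleton.E) (h : C.skeleton.IsWalk (C.projV b v) r) :
    (C.coverGraph b).IsWalk v (C.lift b v r h) := by
  induction r generalizing v with
  | nil => trivial
  | cons e r ih => exact ⟨C.coverTerm_coverInv b _, ih _ _⟩

theorem endpoint_lift (C : TwoComplex.{u}) (b : C.skeleton.V) (v : C.CoverV b)
    (r : List C.skeleton.E) (h : C.skeleton.IsWalk (C.projV b v) r) :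
    (C.coverGraph b).endpoint v (C.lift b v r h) = C.extend b v r h := by
  induction r generalizing v with
  | nil =>
    induction v using Quotient.inductionOn with
    | _ p => simp [lift, MGraph.endpoint, extend_mk]
  | cons e r ih =>
    refine (ih (C.coverTerm b ⟨(v, e), h.1⟩)
      ((C.projV_coverTerm b ⟨(v, e), h.1⟩).symm ▸ h.2)).trans ?_
    induction v using Quotient.inductionOn with
    | _ p =>
      refine congrArg (Quotient.mk (C.homotopy b)) (Subtype.ext ?_)
      simp

theorem map_lift (C : TwoComplex.{u}) (b : C.skeleton.V) (v : C.CoverV b)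
    (r : List C.skeleton.E) (h : C.skeleton.IsWalk (C.projV b v) r) :
    (C.lift b v r h).map (fun d => d.1.2) = r := by
  induction r generalizing v with
  | nil => rfl
  | cons e r ih => exact congrArg (e :: ·) (ih _ _)

theorem extend_bdry (C : TwoComplex.{u}) (b : C.skeleton.V) (v : C.CoverV b) (f : C.F)
    (hf : C.base f = C.projV b v) (h : C.skeleton.IsWalk (C.projV b v) (C.bdry f)) :
    C.extend b v (C.bdry f) h = v := by
  induction v using Quotient.inductionOn with
  | _ p =>
    refine Quotient.sound (s := C.homotopy b) (Relation.EqvGen.symm _ _ ?_)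
    refine Relation.EqvGen.rel _ _ ?_
    have := Step.cell (C := C) (x := b) p.1 [] f hf
    simpa using this

/-- The universal cover of the connected 2-complex `C` with base vertex `b`: its vertices are the
homotopy classes of walks starting at `b`, and there is one lift of each edge and of each 2-cell
at each vertex over the initial vertex of the edge or over the base vertex of the 2-cell. -/
abbrev universalCover (C : TwoComplex.{u}) (b : C.skeleton.V) : TwoComplex.{u} where
  skeleton := C.coverGraph b
  F := {d : C.CoverV b × C.F // C.base d.2 = C.projV b d.1}
  base d := d.1.1
  bdry d := C.lift b d.1.1 (C.bdry d.1.2) (d.2 ▸ C.isWalk_bdry d.1.2)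
  isWalk_bdry _ := C.isWalk_lift b _ _ _
  endpoint_bdry d := (C.endpoint_lift b _ _ _).trans (C.extend_bdry b _ _ d.2 _)

/-- The covering projection. -/
def universalCoverProj (C : TwoComplex.{u}) (b : C.skeleton.V) : Hom (C.universalCover b) C where
  onV := C.projV b
  onE d := d.1.2
  onF d := d.1.2
  map_inv _ := rfl
  map_term d := C.projV_coverTerm b d
  map_base d := d.2.symm
  map_bdry _ := C.map_lift b _ _ _

theorem universalCoverProj_isCovering (C : TwoComplex.{u}) (b : C.skeleton.V)
    (hC : C.skeleton.Connected) : (C.universalCoverProj b).IsCovering where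
  surjective x := by
    obtain ⟨l, hl, hx⟩ := hC.2 b x
    exact ⟨Quotient.mk (C.homotopy b) ⟨l, hl⟩, hx⟩
  edges v := by
    refine ⟨?_, ?_, ?_⟩
    · rintro d rfl
      exact d.2.trans (congrArg (C.projV b) (C.coverTerm_coverInv b d).symm)
    · intro d hd d' hd' h
      have h₁ : d.1.1 = v := (C.coverTerm_coverInv b d).symm.trans hd
      have h₂ : d'.1.1 = v := (C.coverTerm_coverInv b d').symm.trans hd'
      exact Subtype.ext (Prod.ext (h₁.trans h₂.symm) h)
    · intro e he
      exact ⟨⟨(v, e), he⟩, C.coverTerm_coverInv b _, rfl⟩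
  cells v := by
    refine ⟨?_, ?_, ?_⟩
    · rintro d rfl
      exact d.2
    · intro d hd d' hd' h
      exact Subtype.ext (Prod.ext (Eq.trans hd (Eq.symm hd')) h)
    · intro f hf
      exact ⟨⟨(v, f), hf⟩, rfl, rfl⟩

theorem universalCover_connected (C : TwoComplex.{u}) (b : C.skeleton.V) :
    (C.universalCover b).skeleton.Connected := by
  have fwd : ∀ (v w : C.CoverV b), (∃ l, (C.coverGraph b).IsWalk v l ∧
      (C.coverGraph b).endpoint v l = w) → ∃ l, (C.coverGraph b).IsWalk w l ∧
      (C.coverGraph b).endpoint w l = v := by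
    rintro v w ⟨l, hl, rfl⟩
    induction l generalizing v with
    | nil => exact ⟨[], trivial, rfl⟩
    | cons d l ih =>
      obtain ⟨m, hm, hv⟩ := ih _ hl.2
      refine ⟨m ++ [(C.coverGraph b).inv d], ?_, ?_⟩
      · refine (MGraph.isWalk_append _ _ _ _).2 ⟨hm, ?_, trivial⟩
        refine Eq.trans ?_ hv.symm
        exact congrArg (C.coverGraph b).term ((C.coverGraph b).inv_inv d)
      · refine (MGraph.endpoint_append _ _ _ _).trans ?_
        exact hl.1
  have base : ∀ v : C.CoverV b, ∃ l, (C.coverGraph b).IsWalk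
      (Quotient.mk (C.homotopy b) ⟨[], trivial⟩) l ∧
      (C.coverGraph b).endpoint (Quotient.mk (C.homotopy b) ⟨[], trivial⟩) l = v := by
    intro v
    induction v using Quotient.inductionOn with
    | _ p => exact ⟨C.lift b (Quotient.mk (C.homotopy b) ⟨[], trivial⟩) p.1 p.2,
        C.isWalk_lift b _ _ _, C.endpoint_lift b _ _ _⟩
  refine ⟨⟨Quotient.mk (C.homotopy b) ⟨[], trivial⟩⟩, fun v w => ?_⟩
  obtain ⟨l, hl, hv⟩ := fwd _ _ (base v)
  obtain ⟨m, hm, hw⟩ := base w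
  refine ⟨l ++ m, (MGraph.isWalk_append _ _ _ _).2 ⟨hl, ?_⟩,
    (MGraph.endpoint_append _ _ _ _).trans ?_⟩
  · exact (congrArg (fun t => (C.coverGraph b).IsWalk t m) hv).mpr hm
  · exact (congrArg (fun t => (C.coverGraph b).endpoint t m) hv).trans hw

theorem cancel_left (C : TwoComplex.{u}) (x : C.skeleton.V) (p : List C.skeleton.E)
    (hp : C.skeleton.IsWalk x p) (q : List C.skeleton.E)
    (hq : C.skeleton.IsWalk (C.skeleton.endpoint x p) q)
    (h : C.homotopy x ⟨p ++ q, (C.skeleton.isWalk_append x p q).2 ⟨hp, hq⟩⟩ ⟨p, hp⟩) :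
    C.homotopy (C.skeleton.endpoint x p) ⟨q, hq⟩ ⟨[], trivial⟩ := by
  induction p generalizing x with
  | nil => exact h
  | cons e p ih =>
    refine ih (C.skeleton.term e) hp.2 hq ?_
    have he : C.skeleton.init (C.skeleton.inv e) = C.skeleton.term e := by
      rw [MGraph.init, C.skeleton.inv_inv]
    have hi : C.skeleton.term (C.skeleton.inv e) = x := hp.1
    have lead : ∀ r : C.WalkFrom x,
        C.skeleton.IsWalk (C.skeleton.term e) (C.skeleton.inv e :: r.1) := fun r =>
      ⟨he, hi.symm ▸ r.2⟩
    have step : ∀ r s : C.WalkFrom x, C.homotopy x r s →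
        C.homotopy (C.skeleton.term e) ⟨C.skeleton.inv e :: r.1, lead r⟩
          ⟨C.skeleton.inv e :: s.1, lead s⟩ := by
      intro r s hrs
      induction hrs with
      | rel r s hrs =>
        refine Relation.EqvGen.rel _ _ ?_
        obtain ⟨r, hr⟩ := r
        obtain ⟨s, hs⟩ := s
        change C.Step _ (C.skeleton.inv e :: r) (C.skeleton.inv e :: s)
        change C.Step x r s at hrs
        cases hrs with
        | backtrack p q d h =>
          exact Step.backtrack (C.skeleton.inv e :: p) q d (by rw [h, MGraph.endpoint, hi])
        | cell p q f h =>
          exact Step.cell (C.skeleton.inv e :: p) q f (by rw [h, MGraph.endpoint, hi])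
      | refl => exact Relation.EqvGen.refl _
      | symm _ _ _ ih => exact Relation.EqvGen.symm _ _ ih
      | trans _ _ _ _ _ ih₁ ih₂ => exact Relation.EqvGen.trans _ _ _ ih₁ ih₂
    have red : ∀ (r : List C.skeleton.E) (hr : C.skeleton.IsWalk (C.skeleton.term e) r),
        C.homotopy (C.skeleton.term e) ⟨r, hr⟩
          ⟨C.skeleton.inv e :: e :: r, lead ⟨e :: r, hp.1, hr⟩⟩ := by
      intro r hr
      refine Relation.EqvGen.rel _ _ ?_
      have := Step.backtrack (C := C) (x := C.skeleton.term e) [] r (C.skeleton.inv e) he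
      rw [C.skeleton.inv_inv] at this
      exact this
    exact Relation.EqvGen.trans _ _ _ (red _ _)
      (Relation.EqvGen.trans _ _ _ (step _ _ h) (Relation.EqvGen.symm _ _ (red _ _)))

theorem eq_lift (C : TwoComplex.{u}) (b : C.skeleton.V) (v : C.CoverV b) (L : List (C.CoverE b))
    (hL : (C.coverGraph b).IsWalk v L) :
    ∃ h, L = C.lift b v (L.map fun d => d.1.2) h := by
  induction L generalizing v with
  | nil => exact ⟨trivial, rfl⟩
  | cons d L ih =>
    obtain ⟨⟨w, e⟩, hd⟩ := d
    obtain ⟨h₁, h₂⟩ := hL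
    obtain rfl : w = v := (C.coverTerm_coverInv b ⟨(w, e), hd⟩).symm.trans h₁
    obtain ⟨h, hh⟩ := ih _ h₂
    refine ⟨⟨hd, C.projV_coverTerm b ⟨(w, e), hd⟩ ▸ h⟩, ?_⟩
    exact congrArg _ hh

theorem lift_unique (C : TwoComplex.{u}) (b : C.skeleton.V) {v v' : C.CoverV b}
    {L M : List (C.CoverE b)} (hv : v = v')
    (hL : (C.coverGraph b).IsWalk v L) (hM : (C.coverGraph b).IsWalk v' M)
    (h : L.map (fun d => d.1.2) = M.map fun d => d.1.2) : L = M := by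
  subst hv
  obtain ⟨h₁, e₁⟩ := C.eq_lift b v L hL
  obtain ⟨h₂, e₂⟩ := C.eq_lift b v M hM
  rw [e₁, e₂]
  congr 1

theorem step_lift (C : TwoComplex.{u}) (b : C.skeleton.V) (v : C.CoverV b)
    (L M : List (C.CoverE b)) (hL : (C.coverGraph b).IsWalk v L)
    (hM : (C.coverGraph b).IsWalk v M)
    (h : C.Step (C.projV b v) (L.map fun d => d.1.2) (M.map fun d => d.1.2)) :
    (C.universalCover b).Step v L M := by
  generalize hl : (L.map fun d => d.1.2) = l at h
  generalize hm : (M.map fun d => d.1.2) = m at h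
  cases h with
  | backtrack p q e h =>
    obtain ⟨L₁, L₃, rfl, hL₁, hL₃⟩ := List.map_eq_append_iff.1 hl
    obtain ⟨M₁, M', rfl, hM₁, hM'⟩ := List.map_eq_append_iff.1 hm
    obtain ⟨M₂, M₃, rfl, hM₂, hM₃⟩ := List.map_eq_append_iff.1 hM'
    rw [MGraph.isWalk_append] at hL hM
    obtain rfl : L₁ = M₁ := C.lift_unique b rfl hL.1 hM.1 (hL₁.trans hM₁.symm)
    obtain ⟨d, M₂, rfl, hd, hM₂⟩ := List.map_eq_cons_iff.1 hM₂
    have hM2 := hM.2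
    rw [MGraph.isWalk_append] at hM2
    obtain rfl : M₂ = [(C.coverGraph b).inv d] := by
      refine C.lift_unique b rfl hM2.1.2 ⟨?_, trivial⟩ (hM₂.trans ?_)
      · exact congrArg (C.coverGraph b).term ((C.coverGraph b).inv_inv d)
      · subst hd; rfl
    obtain rfl : L₃ = M₃ :=
      C.lift_unique b (hM2.1.1).symm hL.2 hM2.2 (hL₃.trans hM₃.symm)
    exact Step.backtrack (C := C.universalCover b) L₁ L₃ d hM2.1.1
  | cell p q f h =>
    obtain ⟨L₁, L₃, rfl, hL₁, hL₃⟩ := List.map_eq_append_iff.1 hl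
    obtain ⟨M₁, M', rfl, hM₁, hM'⟩ := List.map_eq_append_iff.1 hm
    obtain ⟨M₂, M₃, rfl, hM₂, hM₃⟩ := List.map_eq_append_iff.1 hM'
    rw [MGraph.isWalk_append] at hL hM
    obtain rfl : L₁ = M₁ := C.lift_unique b rfl hL.1 hM.1 (hL₁.trans hM₁.symm)
    have hM2 := hM.2
    rw [MGraph.isWalk_append] at hM2
    have hw : C.base f = C.projV b ((C.coverGraph b).endpoint v L₁) := by
      obtain ⟨h₁, e₁⟩ := C.eq_lift b v L₁ hL.1
      rw [h, e₁, C.endpoint_lift b, C.projV_extend b, hL₁]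
    let c : (C.universalCover b).F := ⟨((C.coverGraph b).endpoint v L₁, f), hw⟩
    have hc : M₂ = (C.universalCover b).bdry c :=
      C.lift_unique b rfl hM2.1 ((C.universalCover b).isWalk_bdry c)
        (hM₂.trans (C.map_lift b _ _ _).symm)
    obtain rfl : L₃ = M₃ := by
      refine C.lift_unique b ?_ hL.2 hM2.2 (hL₃.trans hM₃.symm)
      rw [hc]
      exact ((C.universalCover b).endpoint_bdry c).symm
    rw [hc]
    exact Step.cell (C := C.universalCover b) L₁ L₃ c rfl

/-- Together with `universalCoverProj_isCovering`: `universalCover` is a simply connected cover. -/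
theorem universalCover_simplyConnected (C : TwoComplex.{u}) (b : C.skeleton.V) :
    (C.universalCover b).SimplyConnected := by
  refine ⟨C.universalCover_connected b, ?_⟩
  intro v L hv
  let o : C.CoverV b := Quotient.mk (C.homotopy b) ⟨[], trivial⟩
  have homot : ∀ p q : C.WalkFrom b, C.homotopy b p q → ∀ L M : (C.universalCover b).WalkFrom o,
      L.1.map (fun d => d.1.2) = p.1 → M.1.map (fun d => d.1.2) = q.1 →
      (C.universalCover b).homotopy o L M := by
    intro p q h
    induction h with
    | rel p q h =>
      intro L M hL hM
      refine Relation.EqvGen.rel _ _ (C.step_lift b o L.1 M.1 L.2 M.2 ?_)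
      rw [hL, hM]
      exact h
    | refl p =>
      intro L M hL hM
      rw [Subtype.ext (C.lift_unique b rfl L.2 M.2 (hL.trans hM.symm))]
    | symm _ _ _ ih => exact fun L M hL hM => Relation.EqvGen.symm _ _ (ih M L hM hL)
    | trans p q r _ _ ih₁ ih₂ =>
      intro L M hL hM
      let N : (C.universalCover b).WalkFrom o := ⟨C.lift b o q.1 q.2, C.isWalk_lift b _ _ _⟩
      exact Relation.EqvGen.trans _ _ _ (ih₁ L N hL (C.map_lift b _ _ _))
        (ih₂ N M (C.map_lift b _ _ _) hM)
  obtain ⟨L, hL⟩ := L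
  induction v using Quotient.inductionOn with
  | _ p =>
    have hK : (C.coverGraph b).IsWalk o (C.lift b o p.1 p.2) := C.isWalk_lift b _ _ _
    have hKe : (C.coverGraph b).endpoint o (C.lift b o p.1 p.2) =
        Quotient.mk (C.homotopy b) p := C.endpoint_lift b _ _ _
    obtain ⟨hr, hLr⟩ := C.eq_lift b _ L hL
    have hcl : C.extend b (Quotient.mk (C.homotopy b) p) (L.map fun d => d.1.2) hr =
        Quotient.mk (C.homotopy b) p :=
      (C.endpoint_lift b _ _ hr).symm.trans (hLr ▸ hv)
    have hpr := Quotient.exact (s := C.homotopy b) hcl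
    have key : ∀ (w : C.CoverV b) (hw : w = Quotient.mk (C.homotopy b) p)
        (hLw : (C.coverGraph b).IsWalk w L),
        (C.universalCover b).homotopy w ⟨L, hLw⟩ ⟨[], trivial⟩ →
        (C.universalCover b).homotopy (Quotient.mk (C.homotopy b) p) ⟨L, hL⟩ ⟨[], trivial⟩ := by
      rintro w rfl _ h
      exact h
    refine key _ hKe (hKe ▸ hL) ((C.universalCover b).cancel_left o _ hK L (hKe ▸ hL) ?_)
    refine homot _ _ hpr _ _ ?_ (C.map_lift b _ _ _)
    exact List.map_append.trans (congrArg (· ++ _) (C.map_lift b o p.1 p.2))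

end TwoComplex

/-! ### Partite presentations -/

/-- The free product of infinite cyclic groups, one for each element of `U`, and of cyclic groups of
order 2, one for each element of `I`: the group `⟨U ∪ I | s² = 1 for s ∈ I⟩`. -/
abbrev MF (U I : Type u) : Type u :=
  PresentedGroup (Set.range fun i : I => (FreeGroup.of (Sum.inr i : U ⊕ I)) ^ 2)

/-- The right action `x · (s₁ ⋯ sₙ) = φ(sₙ) ∘ ⋯ ∘ φ(s₁) (x)` of `MF U I` on `X` defined by a map
`φ` from the generators to the permutations of `X`: following a walk labelled `s₁ ⋯ sₙ`. -/
def action {X U I : Type u} (φ : U ⊕ I → Equiv.Perm X) (h : ∀ i, φ (Sum.inr i) ^ 2 = 1) :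
    MF U I →* (Equiv.Perm X)ᵐᵒᵖ :=
  PresentedGroup.toGroup (f := fun s => MulOpposite.op (φ s)) (by
    rintro _ ⟨i, rfl⟩
    simp [← MulOpposite.op_pow, h])

/-- A partite presentation `⟨X | U | I | φ | R⟩`. -/
structure PartitePresentation : Type (u + 1) where
  /-- the vertex classes -/
  X : Type u
  /-- the generators are the elements of the disjoint union of `U` and `I` -/
  U : Type u
  I : Type u
  φ : U ⊕ I → Equiv.Perm X
  nonempty : Nonempty X
  sq_eq_one : ∀ i : I, φ (Sum.inr i) ^ 2 = 1
  fixedPointFree : ∀ (i : I) (x : X), φ (Sum.inr i) x ≠ x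
  transitive : ∀ x y : X, ∃ w : MF U I, (action φ sq_eq_one w).unop x = y
  /-- the relator sets -/
  R : X → Set (MF U I)
  stab : ∀ x, ∀ r ∈ R x, (action φ sq_eq_one r).unop x = x

/-- The letters: the elements of `U ∪ U⁻¹ ∪ I`. -/
inductive Letter (U I : Type u) : Type u
  | pos (s : U)
  | neg (s : U)
  | invol (s : I)

namespace Letter

def inv {U I : Type u} : Letter U I → Letter U I
  | pos s => neg s
  | neg s => pos s
  | invol s => invol s

/-- The element of the group `MF U I` given by a letter. -/
def toMF {U I : Type u} : Letter U I → MF U I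
  | pos s => PresentedGroup.of (Sum.inl s)
  | neg s => (PresentedGroup.of (Sum.inl s))⁻¹
  | invol s => PresentedGroup.of (Sum.inr s)

/-- A word is reduced if no letter in it is followed by its inverse. Each element of `MF U I` is
represented by exactly one reduced word. -/
def Reduced {U I : Type u} (w : List (Letter U I)) : Prop :=
  w.IsChain fun a b => b ≠ a.inv

end Letter

namespace PartitePresentation

/-- The permutation `φ(s)` for `s ∈ U ∪ U⁻¹ ∪ I`, with `φ(s⁻¹) = φ(s)⁻¹`. -/
def perm (P : PartitePresentation.{u}) : Letter P.U P.I → Equiv.Perm P.X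
  | .pos s => P.φ (Sum.inl s)
  | .neg s => (P.φ (Sum.inl s))⁻¹
  | .invol s => P.φ (Sum.inr s)

theorem perm_inv (P : PartitePresentation.{u}) (s : Letter P.U P.I) (x : P.X) :
    P.perm s.inv (P.perm s x) = x := by
  cases s with
  | pos s => simp [perm, Letter.inv]
  | neg s => simp [perm, Letter.inv]
  | invol s =>
    have := congrArg (fun f => f x) (P.sq_eq_one s)
    simpa [perm, Letter.inv, pow_two] using this

theorem action_toMF (P : PartitePresentation.{u}) (s : Letter P.U P.I) :
    (action P.φ P.sq_eq_one s.toMF).unop = P.perm s := by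
  cases s <;> simp [action, Letter.toMF, perm]

/-- The presentation graph: its vertex set is `X`, and for each `x ∈ X` and `s ∈ U ∪ U⁻¹ ∪ I` there
is a directed edge `(x, s)` of colour `s` from `x` to `φ(s)(x)`, whose inverse is the edge
`(φ(s)(x), s⁻¹)`. -/
abbrev graph (P : PartitePresentation.{u}) : MGraph.{u} where
  V := P.X
  E := P.X × Letter P.U P.I
  term e := P.perm e.2 e.1
  inv e := (P.perm e.2 e.1, e.2.inv)
  inv_inv := by
    rintro ⟨x, s⟩
    refine Prod.ext (P.perm_inv s x) ?_
    cases s <;> rfl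
  inv_ne := by
    rintro ⟨x, s⟩ h
    cases s with
    | pos s => exact Letter.noConfusion rfl rfl (heq_of_eq (congrArg Prod.snd h))
    | neg s => exact Letter.noConfusion rfl rfl (heq_of_eq (congrArg Prod.snd h))
    | invol s => exact P.fixedPointFree s x (congrArg Prod.fst h)

/-- The walk in the presentation graph that starts at `x` and is dictated by the word `w`. -/
def walk (P : PartitePresentation.{u}) : P.X → List (Letter P.U P.I) → List (P.X × Letter P.U P.I)
  | _, [] => []
  | x, s :: w => (x, s) :: P.walk (P.perm s x) w

theorem isWalk_walk (P : PartitePresentation.{u}) (x : P.X) (w : List (Letter P.U P.I)) :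
    P.graph.IsWalk x (P.walk x w) := by
  induction w generalizing x with
  | nil => trivial
  | cons s w ih => exact ⟨P.perm_inv s x, ih _⟩

theorem endpoint_walk (P : PartitePresentation.{u}) (x : P.X) (w : List (Letter P.U P.I)) :
    P.graph.endpoint x (P.walk x w) =
      (action P.φ P.sq_eq_one (w.map Letter.toMF).prod).unop x := by
  induction w generalizing x with
  | nil =>
    simp only [walk, MGraph.endpoint, List.map_nil, List.prod_nil, map_one]
    rfl
  | cons s w ih =>
    refine (ih (P.perm s x)).trans ?_
    rw [← P.action_toMF, List.map_cons, List.prod_cons, map_mul]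
    rfl

/-- The partite presentation complex: for each `x ∈ X` and each relator `r ∈ R x`, a 2-cell is glued
to the presentation graph along the walk starting at `x` and dictated by (the reduced word of)
`r`. -/
abbrev complex (P : PartitePresentation.{u}) : TwoComplex.{u} where
  skeleton := P.graph
  F := {c : P.X × List (Letter P.U P.I) // Letter.Reduced c.2 ∧ (c.2.map Letter.toMF).prod ∈ P.R c.1}
  base c := c.1.1
  bdry c := P.walk c.1.1 c.1.2
  isWalk_bdry _ := P.isWalk_walk _ _
  endpoint_bdry c := (P.endpoint_walk _ _).trans (P.stab _ _ c.2.2)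

/-- The partite Cayley graph of `P`: the 1-skeleton of the universal cover of the partite
presentation complex, constructed with base vertex `b`. -/
def cayleyGraph (P : PartitePresentation.{u}) (b : P.X) : MGraph.{u} :=
  (P.complex.universalCover b).skeleton

end PartitePresentation

end Partite

/-! It suffices to colour the directed edges by a set with an involution so that inverse edges have
inverse colours and each vertex emits exactly one edge of each colour. Orbits of the involution then
become generators, those of size one lying in `I`, and `Γ` becomes a presentation graph. Taking
every stabilizer element as a relator makes all closed walks null-homotopic, so the universal cover
has the same 1-skeleton as the complex (`Colourable.exists_presentation`, `nonempty_iso_of_null`).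

To find the colouring (`VertexTransitive.colourable`), split the edges into loops, edges of finite
multiplicity, and one class for each infinite multiplicity. Automorphisms preserve the classes, so
each piece is vertex transitive, though perhaps disconnected, and the pieces can be coloured
separately.

Loops are transported from a base vertex. For an infinite multiplicity, the arcs of the underlying
simple graph split into permutations of the vertices, and each permutation is repeated along the
parallel edges. For finite multiplicity and infinite degree, a generic construction meets countably
many requirements and splits the edges into perfect matchings. For finite even degree, a balanced
orientation and the edge colouring of regular bipartite graphs suffice (Petersen's 2-factor
theorem). For finite odd degree, a perfect matching is removed first. It exists because a connected
vertex-transitive graph of degree `d` has no edge cut smaller than `d` (`le_card_boundary`), which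
yields Tutte's condition on finite pieces; compactness then covers the infinite case. -/

namespace Partite

/-! ### Regular bipartite multigraphs -/

section Bipartite

variable {D A B : Type*}

/-- In a bipartite multigraph with edge set `D` that is regular of finite positive degree, there is
an injection from one side to the other along edges. -/
theorem exists_injective_of_regular (src : D → A) (tgt : D → B) {n : ℕ} (hn : n ≠ 0)
    (hs : ∀ a, (src ⁻¹' {a}).encard = n) (ht : ∀ b, (tgt ⁻¹' {b}).encard = n) :
    ∃ f : A → B, Function.Injective f ∧ ∀ a, ∃ d, src d = a ∧ tgt d = f a := by
  classical
  have fs : ∀ a, (src ⁻¹' {a}).Finite := fun a => Set.finite_of_encard_eq_coe (hs a)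
  have ft : ∀ b, (tgt ⁻¹' {b}).Finite := fun b => Set.finite_of_encard_eq_coe (ht b)
  have cs : ∀ a, (fs a).toFinset.card = n := fun a => by
    have := hs a
    rw [(fs a).encard_eq_coe_toFinset_card] at this
    exact_mod_cast this
  have ct : ∀ b, (ft b).toFinset.card = n := fun b => by
    have := ht b
    rw [(ft b).encard_eq_coe_toFinset_card] at this
    exact_mod_cast this
  -- Hall's condition by double counting: the `n * S.card` edges at `S` all end in the neighbourhood
  -- of `S`, each vertex of which receives only `n` edges.
  obtain ⟨f, hf, h⟩ := (Finset.all_card_le_biUnion_card_iff_exists_injective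
    (fun a => (fs a).toFinset.image tgt)).1 (by
      intro S
      have h₁ : (S.biUnion fun a => (fs a).toFinset).card = S.card * n := by
        rw [Finset.card_biUnion]
        · simp [cs]
        · intro a _ a' _ hne
          refine Finset.disjoint_left.2 ?_
          intro d hd hd'
          simp only [Set.Finite.mem_toFinset, Set.mem_preimage, Set.mem_singleton_iff] at hd hd'
          exact hne (hd.symm.trans hd')
      have h₂ : (S.biUnion fun a => (fs a).toFinset) ⊆
          (S.biUnion fun a => (fs a).toFinset.image tgt).biUnion fun b => (ft b).toFinset := by
        intro d hd
        simp only [Finset.mem_biUnion, Set.Finite.mem_toFinset, Set.mem_preimage,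
          Set.mem_singleton_iff, Finset.mem_image] at hd ⊢
        obtain ⟨a, ha, hd⟩ := hd
        exact ⟨tgt d, ⟨a, ha, d, hd, rfl⟩, rfl⟩
      have h₃ := (Finset.card_le_card h₂).trans
        (Finset.card_biUnion_le_card_mul _ _ n fun b _ => (ct b).le)
      rw [h₁] at h₃
      exact Nat.le_of_mul_le_mul_right h₃ (Nat.pos_of_ne_zero hn))
  refine ⟨f, hf, fun a => ?_⟩
  simpa using h a

/-- A bipartite multigraph that is regular of finite positive degree has a perfect matching. -/
theorem exists_perfect_matching_of_regular (src : D → A) (tgt : D → B) {n : ℕ} (hn : n ≠ 0)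
    (hs : ∀ a, (src ⁻¹' {a}).encard = n) (ht : ∀ b, (tgt ⁻¹' {b}).encard = n) :
    ∃ m : A → D, (∀ a, src (m a) = a) ∧ Function.Bijective (tgt ∘ m) := by
  obtain ⟨f, hf, hfd⟩ := exists_injective_of_regular src tgt hn hs ht
  obtain ⟨g, hg, hgd⟩ := exists_injective_of_regular tgt src hn ht hs
  -- The Schröder–Bernstein bijection only pairs points already paired by `f` or by `g`, so it still
  -- runs along edges.
  obtain ⟨h, hb, hr⟩ := Function.Embedding.schroeder_bernstein_of_rel hf hg
    (fun a b => ∃ d, src d = a ∧ tgt d = b) hfd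
    (fun b => (hgd b).imp fun d hd => ⟨hd.2, hd.1⟩)
  choose m hm using hr
  refine ⟨m, fun a => (hm a).1, ?_⟩
  have : tgt ∘ m = h := funext fun a => (hm a).2
  rwa [this]

/-- Deleting a perfect matching lowers every degree by one. This drives the induction on the degree
below and the reduction from odd to even degree. -/
theorem encard_subtype_fibre {T : Type*} (src : D → T) (M : Set D) {n : ℕ}
    (hs : ∀ a, (src ⁻¹' {a}).encard = (n + 1 : ℕ)) (hM : ∀ a, ∃! d, d ∈ M ∧ src d = a) (a : T) :
    ((fun d : {d // d ∉ M} => src d) ⁻¹' {a}).encard = n := by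
  obtain ⟨d, ⟨hd, hda⟩, huniq⟩ := hM a
  have : Subtype.val '' ((fun d : {d // d ∉ M} => src d) ⁻¹' {a}) = src ⁻¹' {a} \ {d} := by
    ext e
    simp only [Set.mem_image, Set.mem_preimage, Set.mem_singleton_iff, Subtype.exists,
      exists_and_left, exists_prop, exists_eq_right_right, Set.mem_sdiff]
    constructor
    · rintro ⟨h₁, h₂⟩
      exact ⟨h₁, fun h => h₂ (h ▸ hd)⟩
    · rintro ⟨h₁, h₂⟩
      exact ⟨h₁, fun h => h₂ (huniq e ⟨h, h₁⟩)⟩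
  rw [← Subtype.val_injective.encard_image, this,
    Set.encard_sdiff_singleton_of_mem (show d ∈ src ⁻¹' {a} from hda), hs a]
  norm_cast

/-- An `n`-regular bipartite multigraph has an edge colouring by `n` colours in which each colour
class is a perfect matching. -/
theorem exists_colouring_of_regular (n : ℕ) : ∀ {D : Type*} (src : D → A) (tgt : D → B),
    (∀ a, (src ⁻¹' {a}).encard = n) → (∀ b, (tgt ⁻¹' {b}).encard = n) →
    ∃ col : D → Fin n, (∀ a i, ∃! d, src d = a ∧ col d = i) ∧
      ∀ b i, ∃! d, tgt d = b ∧ col d = i := by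
  classical
  induction n with
  | zero =>
    intro D src tgt hs ht
    have : IsEmpty D := ⟨fun d => by
      have := hs (src d)
      simp only [Nat.cast_zero, Set.encard_eq_zero] at this
      exact Set.notMem_empty d (this ▸ rfl)⟩
    exact ⟨isEmptyElim, fun _ i => i.elim0, fun _ i => i.elim0⟩
  | succ n ih =>
    intro D src tgt hs ht
    obtain ⟨m, hm, hb⟩ := exists_perfect_matching_of_regular src tgt n.succ_ne_zero hs ht
    have hMs : ∀ a, ∃! d, d ∈ Set.range m ∧ src d = a := fun a =>
      ⟨m a, ⟨⟨a, rfl⟩, hm a⟩, by rintro _ ⟨⟨a', rfl⟩, h⟩; rw [← h, hm]⟩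
    have hMt : ∀ b, ∃! d, d ∈ Set.range m ∧ tgt d = b := fun b => by
      obtain ⟨a, ha⟩ := hb.2 b
      refine ⟨m a, ⟨⟨a, rfl⟩, ha⟩, ?_⟩
      rintro _ ⟨⟨a', rfl⟩, h⟩
      exact congrArg m (hb.1 (h.trans ha.symm))
    obtain ⟨col, hcs, hct⟩ := ih (fun d : {d // d ∉ Set.range m} => src d)
      (fun d : {d // d ∉ Set.range m} => tgt d)
      (encard_subtype_fibre src _ hs hMs) (encard_subtype_fibre tgt _ ht hMt)
    -- The matching receives the new last colour; the remaining edges keep their inductive colours.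
    let c : D → Fin (n + 1) := fun d =>
      if h : d ∈ Set.range m then Fin.last n else (col ⟨d, h⟩).castSucc
    have c_last : ∀ d, c d = Fin.last n ↔ d ∈ Set.range m := by
      intro d
      by_cases h : d ∈ Set.range m
      · simp only [c, dif_pos h, h]
      · simp only [c, dif_neg h, h, iff_false]
        exact (Fin.castSucc_lt_last _).ne
    have c_cast : ∀ d i, c d = Fin.castSucc i ↔ ∃ h : d ∉ Set.range m, col ⟨d, h⟩ = i := by
      intro d i
      by_cases h : d ∈ Set.range m
      · simp only [c, dif_pos h, h, not_true_eq_false, IsEmpty.exists_iff, iff_false]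
        exact (Fin.castSucc_lt_last _).ne'
      · simp only [c, dif_neg h, h, not_false_eq_true, exists_true_left, Fin.castSucc_inj]
    -- The predicate `s` stands for incidence with a fixed vertex, so that both sides are treated at
    -- once.
    have key : ∀ s : D → Prop, (∃! d, d ∈ Set.range m ∧ s d) →
        (∀ i, ∃! d : {d // d ∉ Set.range m}, s d ∧ col d = i) →
        ∀ i, ∃! d, s d ∧ c d = i := by
      intro s h₁ h₂ i
      refine Fin.lastCases ?_ (fun i => ?_) i
      · simpa only [c_last, and_comm] using h₁
      · simp only [c_cast]
        obtain ⟨d, ⟨hd, hdi⟩, hu⟩ := h₂ i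
        refine ⟨d, ⟨hd, d.2, hdi⟩, ?_⟩
        rintro e ⟨he, hne, hei⟩
        exact congrArg Subtype.val (hu ⟨e, hne⟩ ⟨he, hei⟩)
    exact ⟨c, fun a => key _ (hMs a) (hcs a), fun b => key _ (hMt b) (hct b)⟩

end Bipartite


/-! ### Colourings of graphs -/

namespace MGraph

variable (G : MGraph.{u})

theorem term_inv (e : G.E) : G.term (G.inv e) = G.init e := rfl

theorem init_inv (e : G.E) : G.init (G.inv e) = G.term e := by rw [init, G.inv_inv]

theorem inv_injective : Function.Injective G.inv := fun e e' h => by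
  rw [← G.inv_inv e, h, G.inv_inv]

/-- A colouring of the directed edges of `G` by a set `K` with an involution `ι`: inverse edges have
inverse colours, and exactly one edge of each colour leaves each vertex. -/
structure IsColouring {K : Type*} (ι : K → K) (col : G.E → K) : Prop where
  invol : ∀ k, ι (ι k) = k
  map_inv : ∀ e, col (G.inv e) = ι (col e)
  existsUnique : ∀ x k, ∃! e, G.init e = x ∧ col e = k

/-- A graph is colourable if it has a colouring by some set with involution. -/
def Colourable : Prop :=
  ∃ (K : Type u) (ι : K → K) (col : G.E → K), G.IsColouring ι col

variable {G}

/-- The colour sets built from `ℕ` and `Fin k` live in `Type` and have to be lifted to the universe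
of the graph. -/
theorem IsColouring.colourable {K : Type} {ι : K → K} {col : G.E → K} (h : G.IsColouring ι col) :
    G.Colourable := by
  refine ⟨ULift K, fun k => ⟨ι k.down⟩, fun e => ⟨col e⟩, fun k => ?_, fun e => ?_, fun x k => ?_⟩
  · simp [h.invol]
  · simp [h.map_inv]
  · simpa [ULift.ext_iff] using h.existsUnique x k.down

variable (G)

/-- The subgraph of `G` with all vertices of `G` and a set of edges that is closed under
inversion. -/
abbrev edgeSub (S : Set G.E) (hS : ∀ e ∈ S, G.inv e ∈ S) : MGraph.{u} where
  V := G.V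
  E := S
  inv e := ⟨G.inv e, hS e e.2⟩
  inv_inv e := Subtype.ext (G.inv_inv e)
  inv_ne e h := G.inv_ne e (congrArg Subtype.val h)
  term e := G.term e

/-- A graph is colourable if its edges can be partitioned into colourable subgraphs. -/
theorem colourable_of_partition {ι : Type u} (p : G.E → ι) (hp : ∀ e, p (G.inv e) = p e)
    (h : ∀ i, (G.edgeSub {e | p e = i} fun e he => (hp e).trans he).Colourable) :
    G.Colourable := by
  choose K κ col hcol using h
  -- Membership of an edge in a class is only a propositional equality; this moves colours between
  -- equal indices.
  have hc : ∀ {i j : ι} (hij : i = j) (e : G.E) (hi : p e = i) (hj : p e = j),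
      (⟨i, col i ⟨e, hi⟩⟩ : Σ i, K i) = ⟨j, col j ⟨e, hj⟩⟩ := by
    rintro i _ rfl e hi hj
    rfl
  refine ⟨Σ i, K i, fun k => ⟨k.1, κ k.1 k.2⟩, fun e => ⟨p e, col (p e) ⟨e, rfl⟩⟩, ?_, ?_, ?_⟩
  · rintro ⟨i, k⟩
    simp [(hcol i).invol]
  · intro e
    rw [hc (hp e) (G.inv e) rfl (hp e)]
    exact congrArg (Sigma.mk (p e)) ((hcol (p e)).map_inv ⟨e, rfl⟩)
  · rintro x ⟨i, k⟩
    obtain ⟨⟨e, he⟩, ⟨hx, hk⟩, hu⟩ := (hcol i).existsUnique x k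
    refine ⟨e, ⟨hx, ?_⟩, ?_⟩
    · rw [hc he e rfl he, hk]
    · rintro e' ⟨hx', hk'⟩
      have hi : p e' = i := congrArg Sigma.fst hk'
      rw [hc hi e' rfl hi] at hk'
      exact congrArg Subtype.val (hu ⟨e', hi⟩ ⟨hx', eq_of_heq (Sigma.mk.inj hk').2⟩)

/-! ### Finite even degree: balanced orientations -/

/-- The pairs of mutually inverse directed edges. -/
def edgeSetoid : Setoid G.E where
  r e e' := e' = e ∨ e' = G.inv e
  iseqv :=
    { refl := fun _ => Or.inl rfl
      symm := by
        rintro e _ (rfl | rfl)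
        · exact Or.inl rfl
        · exact Or.inr (G.inv_inv e).symm
      trans := by
        rintro e _ _ (rfl | rfl) (rfl | rfl)
        · exact Or.inl rfl
        · exact Or.inr rfl
        · exact Or.inr rfl
        · exact Or.inl (G.inv_inv e) }

theorem encard_prod_fin {α : Type*} (s : Set α) (k : ℕ) {n : ℕ} (hs : s.encard = n) :
    (s ×ˢ (Set.univ : Set (Fin k))).encard = (n * k : ℕ) := by
  rw [Set.encard_prod, hs, Set.encard_univ]
  simp

/-- A graph in which each vertex has finite degree `2 * k` has an orientation in which each vertex
has outdegree `k`. -/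
theorem exists_balanced_orientation {k : ℕ} (h : ∀ x, {e | G.init e = x}.encard = (2 * k : ℕ)) :
    ∃ O : Set G.E, (∀ e, e ∈ O ↔ G.inv e ∉ O) ∧ ∀ x, {e | e ∈ O ∧ G.init e = x}.encard = k := by
  classical
  -- The matching lemma requires positive degree.
  rcases Nat.eq_zero_or_pos k with rfl | hk
  · have hE : IsEmpty G.E := ⟨fun e => by
      have := h (G.init e)
      simp only [mul_zero, Nat.cast_zero, Set.encard_eq_zero] at this
      exact Set.notMem_empty e (this ▸ rfl)⟩
    exact ⟨∅, fun e => hE.elim e, fun x => by simp⟩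
  let A := Quotient G.edgeSetoid
  let mk : G.E → A := Quotient.mk G.edgeSetoid
  have mk_eq : ∀ e e', mk e' = mk e ↔ e' = e ∨ e' = G.inv e := fun e e' =>
    ⟨fun h => Quotient.exact (s := G.edgeSetoid) h.symm,
      fun h => (Quotient.sound (s := G.edgeSetoid) h).symm⟩
  -- Match undirected edges with `k` copies of each vertex, an edge being joined to all copies of
  -- its ends. Both sides have degree `2 * k`: two directions times `k` copies, and the degree of
  -- the vertex. A perfect matching selects one direction of each edge, with every vertex initial
  -- exactly `k` times.
  obtain ⟨m, hm, hb⟩ := exists_perfect_matching_of_regular (D := G.E × Fin k)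
    (fun d => mk d.1) (fun d => (G.init d.1, d.2)) (n := 2 * k) (by omega) (by
      intro a
      induction a using Quotient.inductionOn with
      | _ e =>
      have : (fun d : G.E × Fin k => mk d.1) ⁻¹' {Quotient.mk G.edgeSetoid e} =
          {e, G.inv e} ×ˢ (Set.univ : Set (Fin k)) := by
        ext d
        simp only [Set.mem_preimage, Set.mem_singleton_iff, Set.mem_prod, Set.mem_univ, and_true,
          Set.mem_insert_iff]
        exact mk_eq e d.1
      rw [this]
      exact encard_prod_fin _ k (Set.encard_pair (G.inv_ne e).symm)) (by
      rintro ⟨x, i⟩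
      have : (fun d : G.E × Fin k => (G.init d.1, d.2)) ⁻¹' {(x, i)} =
          (fun e => (e, i)) '' {e | G.init e = x} := by
        ext ⟨e, j⟩
        simp [Prod.ext_iff, eq_comm]
      rw [this, Function.Injective.encard_image (fun e e' he => congrArg Prod.fst he), h])
  refine ⟨Set.range fun a => (m a).1, fun e => ?_, fun x => ?_⟩
  · have h₁ : ∀ e, e ∈ Set.range (fun a => (m a).1) ↔ (m (mk e)).1 = e := by
      refine fun e => ⟨?_, fun h => ⟨_, h⟩⟩
      rintro ⟨a, rfl⟩
      exact congrArg (fun a => (m a).1) (hm a)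
    have h₂ : mk (G.inv e) = mk e := (mk_eq _ _).2 (Or.inr rfl)
    rw [h₁, h₁, h₂]
    have := (mk_eq _ _).1 (hm (mk e))
    have hne := G.inv_ne e
    constructor
    · intro h h'
      exact hne (h'.symm.trans h)
    · intro h
      exact this.resolve_right h
  · have : {e | e ∈ Set.range (fun a => (m a).1) ∧ G.init e = x} =
        Set.range fun i : Fin k => (m ((Equiv.ofBijective _ hb).symm (x, i))).1 := by
      ext e
      constructor
      · rintro ⟨⟨a, rfl⟩, rfl⟩
        refine ⟨(m a).2, ?_⟩
        have : (Equiv.ofBijective _ hb).symm (G.init (m a).1, (m a).2) = a := by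
          rw [Equiv.symm_apply_eq]
          rfl
        simp only [this]
      · rintro ⟨i, rfl⟩
        exact ⟨⟨_, rfl⟩, congrArg Prod.fst ((Equiv.ofBijective _ hb).apply_symm_apply (x, i))⟩
    rw [this, ← Set.image_univ, Function.Injective.encard_image, Set.encard_univ]
    · simp
    · intro i j hij
      have h₁ := congrArg mk hij
      simp only [hm] at h₁
      exact congrArg Prod.snd ((Equiv.ofBijective _ hb).symm.injective h₁)

/-- A graph that is regular of finite even degree is colourable. -/
theorem colourable_of_even {k : ℕ} (h : ∀ x, {e | G.init e = x}.encard = (2 * k : ℕ)) :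
    G.Colourable := by
  classical
  obtain ⟨O, hO, hk⟩ := G.exists_balanced_orientation h
  have hout : ∀ x, ((fun e : O => G.init e) ⁻¹' {x}).encard = k := by
    intro x
    rw [← hk x, ← Subtype.val_injective.encard_image]
    congr 1
    ext e
    simp [and_comm]
  have hin : ∀ x, ((fun e : O => G.term e) ⁻¹' {x}).encard = k := by
    intro x
    -- The oriented edges entering `x` are the inverses of the non-oriented edges leaving it, of
    -- which `2 * k - k` exist.
    have h₁ : {e | G.init e = x} = {e | e ∈ O ∧ G.init e = x} ∪ {e | e ∉ O ∧ G.init e = x} := by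
      ext e
      by_cases he : e ∈ O <;> simp [he]
    have h₂ := h x
    rw [h₁, Set.encard_union_eq, hk] at h₂
    · have h₃ : {e | e ∉ O ∧ G.init e = x}.encard = k := by
        have hfin : {e | e ∉ O ∧ G.init e = x}.Finite :=
          (Set.finite_of_encard_eq_coe (h x)).subset fun e he => he.2
        rw [hfin.encard_eq_coe_toFinset_card] at h₂ ⊢
        norm_cast at h₂ ⊢
        omega
      rw [← h₃, ← Subtype.val_injective.encard_image, ← G.inv_injective.encard_image]
      congr 1
      ext e
      simp only [Set.mem_image, Set.mem_preimage, Set.mem_singleton_iff, Subtype.exists,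
        exists_and_left, exists_prop, exists_eq_right_right, Set.mem_ofPred_eq]
      constructor
      · rintro ⟨e, ⟨he, heO⟩, rfl⟩
        exact ⟨(hO e).1 heO, (G.init_inv e).trans he⟩
      · rintro ⟨heO, he⟩
        refine ⟨G.inv e, ⟨he, ?_⟩, G.inv_inv e⟩
        by_contra h'
        exact heO ((hO e).2 h')
    · rw [Set.disjoint_left]
      exact fun e h₁ h₂ => h₂.1 h₁.1
  obtain ⟨c, hcs, hct⟩ := exists_colouring_of_regular k (fun e : O => G.init e)
    (fun e : O => G.term e) hout hin
  have hO' : ∀ e, e ∉ O → G.inv e ∈ O := fun e he => by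
    by_contra h'
    exact he ((hO e).2 h')
  -- Each bipartite colour class is a permutation of the vertices. The Boolean tells whether an edge
  -- follows it or its inverse, so no colour is its own inverse.
  let col : G.E → Fin k × Bool := fun e =>
    if h : e ∈ O then (c ⟨e, h⟩, true) else (c ⟨G.inv e, hO' e h⟩, false)
  refine IsColouring.colourable (ι := fun k : Fin k × Bool => (k.1, !k.2)) (col := col)
    ⟨fun k => by simp, fun e => ?_, ?_⟩
  · by_cases he : e ∈ O
    · have h' := (hO e).1 he
      simp [col, he, h', G.inv_inv]
    · have h' := hO' e he
      simp [col, he, h']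
  · rintro x ⟨i, b⟩
    cases b with
    | true =>
      obtain ⟨⟨e, heO⟩, ⟨he, hi⟩, hu⟩ := hcs x i
      refine ⟨e, ⟨he, by simp [col, heO, hi]⟩, ?_⟩
      rintro e' ⟨he', hi'⟩
      by_cases h' : e' ∈ O
      · simp only [col, h', dite_true, Prod.mk.injEq, and_true] at hi'
        exact congrArg Subtype.val (hu ⟨e', h'⟩ ⟨he', hi'⟩)
      · simp [col, h'] at hi'
    | false =>
      obtain ⟨⟨e, heO⟩, ⟨he, hi⟩, hu⟩ := hct x i
      refine ⟨G.inv e, ⟨(G.init_inv e).trans he, ?_⟩, ?_⟩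
      · simp [col, (hO e).1 heO, hi, G.inv_inv]
      rintro e' ⟨he', hi'⟩
      by_cases h' : e' ∈ O
      · simp [col, h'] at hi'
      · simp only [col, h', dite_false, Prod.mk.injEq, and_true] at hi'
        have : G.inv e' = e := congrArg Subtype.val (hu ⟨G.inv e', hO' e' h'⟩ ⟨he', hi'⟩)
        rw [← G.inv_inv e', this]


/-! ### Infinitely many neighbours: generic colourings -/

/-- A finite set of pairs (edge, colour) is a partial colouring if it is the graph of a function
that takes the same value on inverse edges, and different values on edges with the same initial
vertex. -/
structure IsPartialColouring (G : MGraph.{u}) (S : Finset (G.E × ℕ)) : Prop where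
  inv_mem : ∀ e n, (e, n) ∈ S → (G.inv e, n) ∈ S
  functional : ∀ e n m, (e, n) ∈ S → (e, m) ∈ S → n = m
  proper : ∀ e e' n, (e, n) ∈ S → (e', n) ∈ S → G.init e = G.init e' → e = e'

variable {G : MGraph.{u}}

-- A new edge and its inverse may take the colour `n` when `n` is absent at both ends. For a loop,
-- the two would themselves clash at their common vertex.
open Classical in
theorem IsPartialColouring.insert {S : Finset (G.E × ℕ)} (hS : G.IsPartialColouring S) (e : G.E)
    (n : ℕ) (hloop : G.init e ≠ G.term e) (hdom : ∀ m, (e, m) ∉ S)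
    (hcol : ∀ e', (e', n) ∈ S → G.init e' ≠ G.init e ∧ G.init e' ≠ G.term e) :
    G.IsPartialColouring (S ∪ {(e, n), (G.inv e, n)}) := by
  have hdom' : ∀ m, (G.inv e, m) ∉ S := fun m hm => hdom m (by
    simpa only [G.inv_inv] using hS.inv_mem _ _ hm)
  have hi := G.init_inv e
  have hne := G.inv_ne e
  constructor
  · intro e' m h
    simp only [Finset.mem_union, Finset.mem_insert, Finset.mem_singleton, Prod.mk.injEq] at h ⊢
    rcases h with h | ⟨rfl, rfl⟩ | ⟨rfl, rfl⟩
    · exact Or.inl (hS.inv_mem _ _ h)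
    · simp
    · simp [G.inv_inv]
  · intro e' m m' h h'
    simp only [Finset.mem_union, Finset.mem_insert, Finset.mem_singleton, Prod.mk.injEq] at h h'
    rcases h with h | ⟨rfl, rfl⟩ | ⟨rfl, rfl⟩ <;> rcases h' with h' | ⟨h', rfl⟩ | ⟨h', rfl⟩
    · exact hS.functional _ _ _ h h'
    · exact absurd (h' ▸ h) (hdom _)
    · exact absurd (h' ▸ h) (hdom' _)
    · exact absurd h' (hdom _)
    · rfl
    · rfl
    · exact absurd h' (hdom' _)
    · rfl
    · rfl
  · intro e₁ e₂ m h h' h12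
    simp only [Finset.mem_union, Finset.mem_insert, Finset.mem_singleton, Prod.mk.injEq] at h h'
    rcases h with h | ⟨rfl, rfl⟩ | ⟨rfl, rfl⟩ <;> rcases h' with h' | ⟨rfl, h'⟩ | ⟨rfl, h'⟩
    · exact hS.proper _ _ _ h h' h12
    · subst h'
      exact absurd h12 (hcol _ h).1
    · subst h'
      exact absurd (h12.trans hi) (hcol _ h).2
    · exact absurd h12.symm (hcol _ h').1
    · rfl
    · exact absurd (h12.trans hi) hloop
    · exact absurd (h12.symm.trans hi) (hcol _ h').2
    · exact absurd (h12.symm.trans hi) hloop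
    · rfl

-- Only finitely many colours occur in `S`, so an uncoloured edge can take a fresh one.
open Classical in
theorem IsPartialColouring.exists_edge_mem {S : Finset (G.E × ℕ)} (hS : G.IsPartialColouring S)
    (hloop : ∀ e, G.init e ≠ G.term e) (e : G.E) :
    ∃ T, S ⊆ T ∧ G.IsPartialColouring T ∧ ∃ n, (e, n) ∈ T := by
  by_cases h : ∃ n, (e, n) ∈ S
  · exact ⟨S, Finset.Subset.rfl, hS, h⟩
  obtain ⟨n, hn⟩ := Infinite.exists_notMem_finset (S.image Prod.snd)
  refine ⟨_, Finset.subset_union_left, hS.insert e n (hloop e) (fun m hm => h ⟨m, hm⟩)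
    fun e' he' => absurd (Finset.mem_image.2 ⟨_, he', rfl⟩) hn, n, ?_⟩
  simp

-- Only finitely many vertices meet `S`, so `x` has a neighbour untouched by it. An edge from `x` to
-- that neighbour is uncoloured and can take the missing colour `n`.
open Classical in
theorem IsPartialColouring.exists_colour_mem {S : Finset (G.E × ℕ)} (hS : G.IsPartialColouring S)
    (hloop : ∀ e, G.init e ≠ G.term e) (x : G.V) (hx : (G.term '' {e | G.init e = x}).Infinite)
    (n : ℕ) : ∃ T, S ⊆ T ∧ G.IsPartialColouring T ∧ ∃ e, G.init e = x ∧ (e, n) ∈ T := by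
  by_cases h : ∃ e, G.init e = x ∧ (e, n) ∈ S
  · exact ⟨S, Finset.Subset.rfl, hS, h⟩
  obtain ⟨_, ⟨e, rfl, rfl⟩, hy⟩ := hx.exists_notMem_finset (S.image fun d => G.init d.1)
  have hy' : ∀ e' m, (e', m) ∈ S → G.init e' ≠ G.term e := fun e' m he' h' =>
    hy (Finset.mem_image.2 ⟨_, he', h'⟩)
  refine ⟨_, Finset.subset_union_left, hS.insert e n (hloop e) (fun m hm => ?_)
    fun e' he' => ⟨fun h' => h ⟨e', h', he'⟩, hy' _ _ he'⟩, e, rfl, ?_⟩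
  · exact hy' _ _ (hS.inv_mem _ _ hm) (G.init_inv e)
  · simp

/-- The edges of a countable loopless graph in which each vertex has infinitely many neighbours can
be partitioned into countably many perfect matchings. -/
theorem exists_colouring_of_infinite [Countable G.V] [Countable G.E]
    (hloop : ∀ e, G.init e ≠ G.term e)
    (hinf : ∀ x, (G.term '' {e | G.init e = x}).Infinite) :
    ∃ col : G.E → ℕ, G.IsColouring id col := by
  classical
  let P := {S : Finset (G.E × ℕ) // G.IsPartialColouring S}
  have : Encodable (G.E ⊕ G.V × ℕ) := Encodable.ofCountable _
  -- Countably many requirements: every edge gets a colour, and every colour occurs at every vertex.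
  -- Each is cofinal by the extension lemmas, so one ideal meets them all (Rasiowa–Sikorski).
  let 𝒟 : G.E ⊕ G.V × ℕ → Order.Cofinal P := fun i => match i with
    | Sum.inl e =>
      { carrier := {S | ∃ n, (e, n) ∈ S.1}
        isCofinal := fun S => by
          obtain ⟨T, hST, hT, h⟩ := S.2.exists_edge_mem hloop e
          exact ⟨⟨T, hT⟩, h, hST⟩ }
    | Sum.inr (x, n) =>
      { carrier := {S | ∃ e, G.init e = x ∧ (e, n) ∈ S.1}
        isCofinal := fun S => by
          obtain ⟨T, hST, hT, h⟩ := S.2.exists_colour_mem hloop x (hinf x) n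
          exact ⟨⟨T, hT⟩, h, hST⟩ }
  let o : P := ⟨∅, by constructor <;> simp⟩
  let J := Order.idealOfCofinals o 𝒟
  have hJ : ∀ S ∈ J, ∀ T ∈ J, ∃ R ∈ J, S ≤ R ∧ T ≤ R := fun S hS T hT => J.directed S hS T hT
  have hE : ∀ e, ∃ n, ∃ S ∈ J, (e, n) ∈ S.1 := fun e => by
    obtain ⟨S, ⟨n, hn⟩, hS⟩ := Order.cofinal_meets_idealOfCofinals o 𝒟 (Sum.inl e)
    exact ⟨n, S, hS, hn⟩
  have hV : ∀ x n, ∃ e, G.init e = x ∧ ∃ S ∈ J, (e, n) ∈ S.1 := fun x n => by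
    obtain ⟨S, ⟨e, hx, hn⟩, hS⟩ := Order.cofinal_meets_idealOfCofinals o 𝒟 (Sum.inr (x, n))
    exact ⟨e, hx, S, hS, hn⟩
  choose col hcol using hE
  -- Any two members of the ideal lie in a common partial colouring, so their union is single
  -- valued.
  have huniq : ∀ e n, (∃ S ∈ J, (e, n) ∈ S.1) → col e = n := by
    rintro e n ⟨S, hS, hn⟩
    obtain ⟨T, hT, hn'⟩ := hcol e
    obtain ⟨R, hR, hSR, hTR⟩ := hJ S hS T hT
    exact R.2.functional _ _ _ (hTR hn') (hSR hn)
  refine ⟨col, fun _ => rfl, fun e => ?_, fun x n => ?_⟩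
  · obtain ⟨S, hS, hn⟩ := hcol e
    exact huniq _ _ ⟨S, hS, S.2.inv_mem _ _ hn⟩
  · obtain ⟨e, hx, S, hS, hn⟩ := hV x n
    refine ⟨e, ⟨hx, huniq _ _ ⟨S, hS, hn⟩⟩, ?_⟩
    rintro e' ⟨hx', rfl⟩
    obtain ⟨T, hT, hn'⟩ := hcol e'
    obtain ⟨R, hR, hSR, hTR⟩ := hJ S hS T hT
    exact R.2.proper _ _ _ (hTR hn') (hSR hn) (hx'.trans hx.symm)

theorem Hom.map_init {G H : MGraph.{u}} (f : Hom G H) (e : G.E) :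
    f.onV (G.init e) = H.init (f.onE e) := by
  rw [init, f.map_term, f.map_inv, init]

/-- A vertex-transitive graph in which all edges are loops is colourable. -/
theorem colourable_of_loops [Nonempty G.V] (hG : G.VertexTransitive)
    (hloop : ∀ e, G.term e = G.init e) : G.Colourable := by
  obtain ⟨o⟩ := ‹Nonempty G.V›
  choose f hf using hG o
  have hinit : ∀ x e, G.init ((f x).onE e) = x ↔ G.init e = o := fun x e => by
    rw [← (f x).map_init]
    exact ⟨fun h => (f x).bijective_onV.1 (h.trans (hf x).symm), fun h => h ▸ hf x⟩
  -- The colour of a loop at `x` is its preimage at `o` under the chosen automorphism taking `o` to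
  -- `x`. Inversion preserves the set of loops at `o` and provides the involution on colours.
  have hex : ∀ e, ∃ k : {e // G.init e = o}, (f (G.init e)).onE k = e := fun e => by
    obtain ⟨k, hk⟩ := (f (G.init e)).bijective_onE.2 e
    exact ⟨⟨k, (hinit (G.init e) k).1 (by rw [hk])⟩, hk⟩
  choose col hcol using hex
  refine ⟨{e // G.init e = o}, fun k => ⟨G.inv k, by rw [G.init_inv, hloop, k.2]⟩, col,
    fun k => Subtype.ext (G.inv_inv k), fun e => Subtype.ext ?_, fun x k => ?_⟩
  · apply (f (G.init e)).bijective_onE.1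
    have h₁ := hcol (G.inv e)
    rw [G.init_inv, hloop] at h₁
    rw [h₁, (f (G.init e)).map_inv, hcol]
  · refine ⟨(f x).onE k, ⟨(hinit x k).2 k.2, Subtype.ext ?_⟩, ?_⟩
    · apply (f x).bijective_onE.1
      have h₁ := hcol ((f x).onE k)
      rwa [(hinit x k).2 k.2] at h₁
    · rintro e ⟨rfl, rfl⟩
      exact (hcol e).symm

/-! ### Infinite multiplicities -/

/-- The arcs of a countable graph that is regular, of finite or infinite degree, can be partitioned
into permutations of the vertices. -/
theorem exists_arc_colouring {V : Type u} [Countable V] (H : SimpleGraph V)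
    (hreg : (∃ n : ℕ, ∀ x, {y | H.Adj x y}.encard = n) ∨ ∀ x, {y | H.Adj x y}.Infinite) :
    ∃ (J : Type) (c : ∀ x y, H.Adj x y → J), (∀ x j, ∃! y, ∃ h, c x y h = j) ∧
      ∀ y j, ∃! x, ∃ h, c x y h = j := by
  classical
  rcases hreg with ⟨n, hn⟩ | hinf
  -- Tails and heads of arcs form a bipartite double graph. The two arcs of an edge are coloured
  -- independently, so no parity condition arises.
  · obtain ⟨c, hs, ht⟩ := exists_colouring_of_regular n
      (fun d : {p : V × V // H.Adj p.1 p.2} => d.1.1)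
      (fun d : {p : V × V // H.Adj p.1 p.2} => d.1.2) (by
        intro x
        have : (fun d : {p : V × V // H.Adj p.1 p.2} => d.1.1) ⁻¹' {x} =
            Set.range fun y : {y | H.Adj x y} => ⟨(x, y.1), y.2⟩ := by
          ext ⟨⟨x', y⟩, h⟩
          constructor
          · rintro rfl
            exact ⟨⟨y, h⟩, rfl⟩
          · rintro ⟨⟨y', h'⟩, he⟩
            exact (congrArg (fun d => d.1.1) he).symm
        rw [this, ← hn x, ← Set.image_univ, Function.Injective.encard_image, Set.encard_univ]
        · rfl
        · exact fun y y' h => Subtype.ext (congrArg (fun d => d.1.2) h)) (by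
        intro x
        have : (fun d : {p : V × V // H.Adj p.1 p.2} => d.1.2) ⁻¹' {x} =
            Set.range fun y : {y | H.Adj x y} => ⟨(y.1, x), y.2.symm⟩ := by
          ext ⟨⟨y, x'⟩, h⟩
          constructor
          · rintro rfl
            exact ⟨⟨y, h.symm⟩, rfl⟩
          · rintro ⟨⟨y', h'⟩, he⟩
            exact (congrArg (fun d => d.1.2) he).symm
        rw [this, ← hn x, ← Set.image_univ, Function.Injective.encard_image, Set.encard_univ]
        · rfl
        · exact fun y y' h => Subtype.ext (congrArg (fun d => d.1.1) h))
    refine ⟨Fin n, fun x y h => c ⟨(x, y), h⟩, fun x j => ?_, fun y j => ?_⟩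
    · obtain ⟨⟨⟨x', y⟩, h⟩, ⟨rfl, hj⟩, hu⟩ := hs x j
      refine ⟨y, ⟨h, hj⟩, ?_⟩
      rintro y' ⟨h', hj'⟩
      exact congrArg (fun d => d.1.2) (hu ⟨(_, y'), h'⟩ ⟨rfl, hj'⟩)
    · obtain ⟨⟨⟨x, y'⟩, h⟩, ⟨rfl, hj⟩, hu⟩ := ht y j
      refine ⟨x, ⟨h, hj⟩, ?_⟩
      rintro x' ⟨h', hj'⟩
      exact congrArg (fun d => d.1.1) (hu ⟨(x', _), h'⟩ ⟨rfl, hj'⟩)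
  · let G : MGraph.{u} :=
      { V := V
        E := {p : V × V // H.Adj p.1 p.2}
        inv := fun d => ⟨(d.1.2, d.1.1), d.2.symm⟩
        inv_inv := fun d => rfl
        inv_ne := fun d h => d.2.ne (congrArg (fun d => d.1.2) h)
        term := fun d => d.1.2 }
    have : Countable G.V := ‹Countable V›
    have : Countable G.E := inferInstanceAs (Countable {p : V × V // H.Adj p.1 p.2})
    obtain ⟨col, hcol⟩ := exists_colouring_of_infinite (G := G) (fun d => d.2.ne) (fun x => by
      refine (hinf x).mono fun y hy => ⟨⟨(x, y), hy⟩, rfl, rfl⟩)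
    have hc : ∀ x j, ∃! y, ∃ h : H.Adj x y, col ⟨(x, y), h⟩ = j := fun x j => by
      obtain ⟨⟨⟨x', y⟩, h⟩, ⟨rfl, hj⟩, hu⟩ := hcol.existsUnique x j
      refine ⟨y, ⟨h, hj⟩, ?_⟩
      rintro y' ⟨h', hj'⟩
      exact congrArg (fun d : G.E => d.1.2) (hu ⟨(_, y'), h'⟩ ⟨rfl, hj'⟩)
    -- The generic colouring gives both arcs of an edge the same colour, so uniqueness at tails
    -- yields uniqueness at heads.
    have hsymm : ∀ x y (h : H.Adj x y), col ⟨(x, y), h⟩ = col ⟨(y, x), h.symm⟩ := fun x y h =>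
      (hcol.map_inv ⟨(x, y), h⟩).symm
    refine ⟨ℕ, fun x y h => col ⟨(x, y), h⟩, hc, fun y j => ?_⟩
    obtain ⟨x, ⟨h, hj⟩, hu⟩ := hc y j
    refine ⟨x, ⟨h.symm, (hsymm _ _ _).trans hj⟩, ?_⟩
    rintro x' ⟨h', hj'⟩
    exact hu x' ⟨h'.symm, (hsymm _ _ _).trans hj'⟩

/-- The simple graph underlying a loopless graph. -/
def simple (G : MGraph.{u}) (hloop : ∀ e, G.init e ≠ G.term e) : SimpleGraph G.V where
  Adj x y := ∃ e, G.init e = x ∧ G.term e = y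
  symm := ⟨by
    rintro x y ⟨e, rfl, rfl⟩
    exact ⟨G.inv e, G.init_inv e, rfl⟩⟩
  loopless := ⟨by
    rintro x ⟨e, rfl, h⟩
    exact hloop e h.symm⟩

theorem simple_adj_map {hloop : ∀ e, G.init e ≠ G.term e} (f : Iso G G) (x y : G.V) :
    (G.simple hloop).Adj (f.onV x) (f.onV y) ↔ (G.simple hloop).Adj x y := by
  constructor
  · rintro ⟨e, hx, hy⟩
    obtain ⟨e, rfl⟩ := f.bijective_onE.2 e
    rw [← f.map_init] at hx
    rw [← f.map_term] at hy
    exact ⟨e, f.bijective_onV.1 hx, f.bijective_onV.1 hy⟩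
  · rintro ⟨e, rfl, rfl⟩
    exact ⟨f.onE e, (f.map_init e).symm, (f.map_term e).symm⟩

theorem encard_simple_neighbours {hloop : ∀ e, G.init e ≠ G.term e} (hG : G.VertexTransitive)
    (x y : G.V) :
    {z | (G.simple hloop).Adj x z}.encard = {z | (G.simple hloop).Adj y z}.encard := by
  obtain ⟨f, rfl⟩ := hG x y
  rw [← f.bijective_onV.1.encard_image]
  congr 1
  ext z
  obtain ⟨z, rfl⟩ := f.bijective_onV.2 z
  simp [f.bijective_onV.1.eq_iff, simple_adj_map]

/-- A countable loopless vertex-transitive graph in which any two adjacent vertices are joined by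
the same infinite number of edges is colourable. -/
theorem colourable_of_infinite_multiplicity [Countable G.V] (hG : G.VertexTransitive)
    (hloop : ∀ e, G.init e ≠ G.term e) (A : Type u) [Infinite A]
    (hA : ∀ e, Nonempty ({e' // G.init e' = G.init e ∧ G.term e' = G.term e} ≃ A)) :
    G.Colourable := by
  classical
  obtain ⟨r, hr⟩ := exists_injective_nat G.V
  obtain ⟨J, c, hc₁, hc₂⟩ := exists_arc_colouring (G.simple hloop) (by
    by_cases h : ∃ x, {y | (G.simple hloop).Adj x y}.Finite
    · obtain ⟨x, hx⟩ := h
      exact Or.inl ⟨hx.toFinset.card, fun y => by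
        rw [encard_simple_neighbours hG y x, hx.encard_eq_coe_toFinset_card]⟩
    · exact Or.inr fun x hx => h ⟨x, hx⟩)
  -- Infinitude of `A` allows each bundle of parallel edges to be halved: one half will follow a
  -- permutation, the other half an inverse permutation.
  obtain ⟨φ⟩ : Nonempty (A ≃ A × Bool) := by
    rw [← Cardinal.eq]
    simpa using (Cardinal.mul_eq_left (Cardinal.aleph0_le_mk A)
      ((Cardinal.natCast_lt_aleph0 (n := 2)).le.trans (Cardinal.aleph0_le_mk A)) two_ne_zero).symm
  have hg : ∀ x y, ∃ g : G.E → A × Bool, (G.simple hloop).Adj x y →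
      ∀ k, ∃! e, (G.init e = x ∧ G.term e = y) ∧ g e = k := by
    intro x y
    by_cases h : (G.simple hloop).Adj x y
    · obtain ⟨e, rfl, rfl⟩ := h
      obtain ⟨ψ⟩ := hA e
      obtain ⟨g, hg⟩ : ∃ g : G.E → A × Bool,
          ∀ e' : {e' // G.init e' = G.init e ∧ G.term e' = G.term e}, g e' = φ (ψ e') :=
        ⟨fun e' => if h : G.init e' = G.init e ∧ G.term e' = G.term e then φ (ψ ⟨e', h⟩)
          else φ (ψ ⟨e, rfl, rfl⟩), fun e' => by simp [e'.2]⟩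
      refine ⟨g, fun _ k => ⟨ψ.symm (φ.symm k), ⟨(ψ.symm (φ.symm k)).2, by simp [hg]⟩, ?_⟩⟩
      rintro e' ⟨he', rfl⟩
      rw [hg ⟨e', he'⟩]
      simp
    · exact ⟨fun _ => φ (Classical.arbitrary A), fun h' => absurd h' h⟩
  choose g hg using hg
  let swap : A × Bool → A × Bool := fun k => (k.1, !k.2)
  have swap_swap : ∀ k, swap (swap k) = k := fun k => by simp [swap]
  -- The labelling of a bundle is chosen from its end of smaller `r`-value and carried to the
  -- inverse edges with the Boolean flipped. Hence `β` is bijective on each bundle and compatible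
  -- with inversion.
  let β : G.E → A × Bool := fun e =>
    if r (G.init e) < r (G.term e) then g (G.init e) (G.term e) e
    else swap (g (G.term e) (G.init e) (G.inv e))
  have hβ_inv : ∀ e, β (G.inv e) = swap (β e) := by
    intro e
    have hne : r (G.init e) ≠ r (G.term e) := fun h => hloop e (hr h)
    simp only [β, G.init_inv, G.term_inv, G.inv_inv]
    rcases lt_or_gt_of_ne hne with h | h
    · rw [if_pos h, if_neg h.not_gt]
    · rw [if_pos h, if_neg h.not_gt, swap_swap]
  have hβ : ∀ x y, (G.simple hloop).Adj x y → ∀ k,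
      ∃! e, (G.init e = x ∧ G.term e = y) ∧ β e = k := by
    intro x y hxy k
    have hne : r x ≠ r y := fun h => hxy.ne (hr h)
    rcases lt_or_gt_of_ne hne with h | h
    · obtain ⟨e, ⟨⟨rfl, rfl⟩, hk⟩, hu⟩ := hg x y hxy k
      refine ⟨e, ⟨⟨rfl, rfl⟩, by simp only [β, if_pos h, hk]⟩, ?_⟩
      rintro e' ⟨⟨hx, hy⟩, hk'⟩
      simp only [β, hx, hy, if_pos h] at hk'
      exact hu e' ⟨⟨hx, hy⟩, hk'⟩
    · obtain ⟨e, ⟨⟨rfl, rfl⟩, hk⟩, hu⟩ := hg y x hxy.symm (swap k)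
      refine ⟨G.inv e, ⟨⟨G.init_inv e, rfl⟩, ?_⟩, ?_⟩
      · rw [hβ_inv]
        simp only [β, if_pos h, hk, swap_swap]
      · rintro e' ⟨⟨hx, hy⟩, hk'⟩
        simp only [β, hx, hy, if_neg h.not_gt] at hk'
        rw [← hu (G.inv e') ⟨⟨(G.init_inv e').trans hy, hx⟩, by rw [← hk', swap_swap]⟩, G.inv_inv]
  have hadj : ∀ e, (G.simple hloop).Adj (G.init e) (G.term e) := fun e => ⟨e, rfl, rfl⟩
  -- At `x`, the colour `(a, j, true)` leads to the image of `x` under the permutation `j`, and `(a,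
  -- j, false)` to its preimage; `a` selects the parallel edge.
  let col : G.E → A × J × Bool := fun e =>
    ((β e).1, if (β e).2 then c _ _ (hadj e) else c _ _ (hadj e).symm, (β e).2)
  have hcc : ∀ x y x' y' (h : (G.simple hloop).Adj x y) (h' : (G.simple hloop).Adj x' y'),
      x = x' → y = y' → c x y h = c x' y' h' := by
    rintro x y _ _ h h' rfl rfl
    rfl
  refine ⟨A × J × Bool, fun k => (k.1, k.2.1, !k.2.2), col, fun k => by simp, fun e => ?_, ?_⟩
  · refine Prod.ext ?_ (Prod.ext ?_ ?_)
    · simp only [col, hβ_inv, swap]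
    · simp only [col, hβ_inv, swap]
      cases (β e).2
      · exact hcc _ _ _ _ _ _ (G.init_inv e) (G.term_inv e)
      · exact hcc _ _ _ _ _ _ (G.term_inv e) (G.init_inv e)
    · simp only [col, hβ_inv, swap]
  · rintro x ⟨a, j, b⟩
    cases b with
    | true =>
      obtain ⟨y, ⟨hxy, hj⟩, hyu⟩ := hc₁ x j
      obtain ⟨e, ⟨⟨rfl, rfl⟩, hk⟩, hu⟩ := hβ x y hxy (a, true)
      refine ⟨e, ⟨rfl, by simp [col, hk, hj]⟩, ?_⟩
      rintro e' ⟨hx', hk'⟩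
      simp only [col, Prod.mk.injEq] at hk'
      obtain ⟨h₁, h₂, h₃⟩ := hk'
      rw [h₃, if_pos rfl] at h₂
      refine hu e' ⟨⟨hx', hyu _ ⟨⟨e', hx', rfl⟩, ?_⟩⟩, Prod.ext h₁ h₃⟩
      exact (hcc _ _ _ _ _ _ hx'.symm rfl).trans h₂
    | false =>
      obtain ⟨y, ⟨hxy, hj⟩, hyu⟩ := hc₂ x j
      obtain ⟨e, ⟨⟨rfl, rfl⟩, hk⟩, hu⟩ := hβ x y hxy.symm (a, false)
      refine ⟨e, ⟨rfl, by simp [col, hk, hj]⟩, ?_⟩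
      rintro e' ⟨hx', hk'⟩
      simp only [col, Prod.mk.injEq] at hk'
      obtain ⟨h₁, h₂, h₃⟩ := hk'
      rw [h₃] at h₂
      refine hu e' ⟨⟨hx', hyu _ ⟨(hx' ▸ hadj e').symm, ?_⟩⟩, Prod.ext h₁ h₃⟩
      exact (hcc _ _ _ _ _ _ rfl hx'.symm).trans h₂

end MGraph

/-! ### Perfect matchings of vertex-transitive graphs -/

section Matching

open Classical

theorem mem_map_iso {V : Type*} {G : SimpleGraph V} (σ : G ≃g G) (A : Finset V) (x : V) :
    σ x ∈ A.map σ.toEquiv.toEmbedding ↔ x ∈ A :=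
  Finset.mem_map' σ.toEquiv.toEmbedding

variable {V : Type*} (G : SimpleGraph V) [G.LocallyFinite]

/-- The arcs from a finite set of vertices to its complement. -/
noncomputable def boundary (C : Finset V) : Finset (Σ _ : V, V) :=
  C.sigma fun x => G.neighborFinset x \ C

variable {G}

theorem mem_boundary {C : Finset V} {a : Σ _ : V, V} :
    a ∈ boundary G C ↔ a.1 ∈ C ∧ a.2 ∉ C ∧ G.Adj a.1 a.2 := by
  simp [boundary, and_comm]

/-- Submodularity of the cut function. The union of the two boundaries on the left lies in the union
of those on the right, and likewise for their intersections. -/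
theorem card_boundary_inter_add_union (A B : Finset V) :
    (boundary G (A ∩ B)).card + (boundary G (A ∪ B)).card ≤
      (boundary G A).card + (boundary G B).card := by
  rw [← Finset.card_union_add_card_inter, ← Finset.card_union_add_card_inter (boundary G A)]
  refine add_le_add (Finset.card_le_card fun a => ?_) (Finset.card_le_card fun a => ?_) <;>
  · simp only [Finset.mem_union, Finset.mem_inter, mem_boundary]
    tauto

theorem card_boundary_map (σ : G ≃g G) (A : Finset V) :
    (boundary G (A.map σ.toEquiv.toEmbedding)).card = (boundary G A).card := by
  symm
  refine Finset.card_bij (fun a _ => ⟨σ a.1, σ a.2⟩) (fun a ha => ?_) (fun a _ b _ h => ?_)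
    fun b hb => ?_
  · rw [mem_boundary] at ha ⊢
    simpa only [mem_map_iso, σ.map_adj_iff] using ha
  · obtain ⟨x, y⟩ := a
    obtain ⟨x', y'⟩ := b
    simpa using h
  · obtain ⟨x, y⟩ := b
    obtain ⟨x, rfl⟩ := σ.surjective x
    obtain ⟨y, rfl⟩ := σ.surjective y
    simp only [mem_boundary, mem_map_iso, σ.map_adj_iff] at hb
    exact ⟨⟨x, y⟩, mem_boundary.2 hb, rfl⟩

/-- In a connected vertex-transitive graph of degree `d`, at least `d` edges leave each finite
nonempty proper set of vertices. -/
theorem le_card_boundary (hG : G.Connected) (ht : ∀ x y, ∃ σ : G ≃g G, σ x = y) {d : ℕ}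
    (hd : ∀ x, G.degree x = d) {C : Finset V} (hne : C.Nonempty) (hC : ∃ x, x ∉ C) :
    d ≤ (boundary G C).card := by
  -- Let `l` be the least size of a cut and, below, `A` a smallest set attaining it (an atom).
  have hex : ∃ l, ∃ C : Finset V, (C.Nonempty ∧ ∃ x, x ∉ C) ∧ (boundary G C).card = l :=
    ⟨_, C, ⟨hne, hC⟩, rfl⟩
  refine le_trans ?_ (Nat.find_min' hex ⟨C, ⟨hne, hC⟩, rfl⟩)
  have hmin : ∀ C : Finset V, (C.Nonempty ∧ ∃ x, x ∉ C) → Nat.find hex ≤ (boundary G C).card :=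
    fun C hC => Nat.find_min' hex ⟨C, hC, rfl⟩
  have hspec := Nat.find_spec hex
  generalize Nat.find hex = l at hmin hspec ⊢
  clear hex hne hC C
  have hex : ∃ n, ∃ C : Finset V, ((C.Nonempty ∧ ∃ x, x ∉ C) ∧ (boundary G C).card ≤ l) ∧
      C.card = n := by
    obtain ⟨C, hC, hl⟩ := hspec
    exact ⟨_, C, ⟨hC, hl.le⟩, rfl⟩
  have hmin' : ∀ C : Finset V, (C.Nonempty ∧ ∃ x, x ∉ C) → (boundary G C).card ≤ l →
      Nat.find hex ≤ C.card := fun C hC hl => Nat.find_min' hex ⟨C, ⟨hC, hl⟩, rfl⟩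
  obtain ⟨A, ⟨⟨⟨a, ha⟩, hA⟩, hl⟩, hn⟩ := Nat.find_spec hex
  rw [← hn] at hmin'
  clear hn hex
  -- An atom equals any translate that it meets: by submodularity the intersection is again a
  -- minimum cut, hence no smaller than `A`.
  have hstab : ∀ σ : G ≃g G, (∃ x ∈ A, σ x ∈ A) → A.map σ.toEquiv.toEmbedding = A := by
    rintro σ ⟨x, hx, hσx⟩
    let B := A.map σ.toEquiv.toEmbedding
    have hBc : B.card = A.card := Finset.card_map _
    have hBl : (boundary G B).card ≤ l := (card_boundary_map σ A).trans_le hl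
    have hxB : σ x ∈ A ∩ B := Finset.mem_inter.2 ⟨hσx, Finset.mem_map.2 ⟨x, hx, rfl⟩⟩
    -- If `A ∪ B` were everything, then `B \ A` would be the complement of `A`. Its boundary arcs
    -- are reversed arcs of `boundary G A`, yet it is smaller than `A`.
    have hun : ∃ y, y ∉ A ∪ B := by
      by_contra! hall
      obtain ⟨z, hz⟩ := hA
      have hz' : z ∈ B \ A := by
        have := hall z
        rw [Finset.mem_union] at this
        exact Finset.mem_sdiff.2 ⟨this.resolve_left hz, hz⟩
      have h₁ := hmin' (B \ A) ⟨⟨z, hz'⟩, ⟨a, by simp [ha]⟩⟩ (by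
        refine le_trans (Finset.card_le_card_of_injOn (fun b => ⟨b.2, b.1⟩) ?_ ?_) hl
        · intro b hb
          rw [Finset.mem_coe, mem_boundary] at hb ⊢
          obtain ⟨h₁, h₂, h₃⟩ := hb
          have := hall b.2
          simp only [Finset.mem_union, Finset.mem_sdiff, not_and, not_not] at this h₁ h₂
          exact ⟨this.elim id h₂, h₁.2, h₃.symm⟩
        · rintro ⟨x, y⟩ _ ⟨x', y'⟩ _ h
          simpa [and_comm] using h)
      have h₂ : (B \ A).card < B.card :=
        Finset.card_lt_card ⟨Finset.sdiff_subset, fun h =>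
          (Finset.mem_sdiff.1 (h (Finset.mem_inter.1 hxB).2)).2 hσx⟩
      omega
    have h₁ := card_boundary_inter_add_union (G := G) A B
    have h₂ := hmin (A ∪ B) ⟨⟨a, Finset.mem_union_left _ ha⟩, hun⟩
    have h₃ := hmin' (A ∩ B) ⟨⟨_, hxB⟩, hA.imp fun y hy h => hy (Finset.mem_inter.1 h).1⟩ (by omega)
    have h₄ : A ∩ B = A := Finset.eq_of_subset_of_card_le Finset.inter_subset_left h₃
    have h₅ : A ∩ B = B := Finset.eq_of_subset_of_card_le Finset.inter_subset_right (by omega)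
    exact h₅.symm.trans h₄
  -- An automorphism taking `a` to `x` preserves `A`, so all vertices of `A` send equally many edges
  -- out of `A`.
  have hout : ∀ x ∈ A, (G.neighborFinset x \ A).card = (G.neighborFinset a \ A).card := by
    intro x hx
    obtain ⟨σ, rfl⟩ := ht a x
    have hσ := hstab σ ⟨a, ha, hx⟩
    have hmem : ∀ y, σ y ∈ A ↔ y ∈ A := fun y => by
      conv_lhs => rw [← hσ]
      exact mem_map_iso σ A y
    symm
    refine Finset.card_bij (fun y _ => σ y) (fun y hy => ?_) (fun y _ z _ h => σ.injective h)
      fun y hy => ?_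
    · simpa [hmem, σ.map_adj_iff] using hy
    · obtain ⟨y, rfl⟩ := σ.surjective y
      exact ⟨y, by simpa [hmem, σ.map_adj_iff] using hy, rfl⟩
  have hcard : (boundary G A).card = A.card * (G.neighborFinset a \ A).card := by
    rw [boundary, Finset.card_sigma, Finset.sum_congr rfl hout, Finset.sum_const, smul_eq_mul]
  have hpos : 0 < (boundary G A).card := by
    obtain ⟨z, hz⟩ := hA
    obtain ⟨w⟩ := hG.preconnected a z
    obtain ⟨b, -, h₁, h₂⟩ := w.exists_boundary_dart (A : Set V) ha hz
    exact Finset.card_pos.2 ⟨⟨b.fst, b.snd⟩, mem_boundary.2 ⟨h₁, h₂, b.adj⟩⟩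
  have hdeg : d ≤ (G.neighborFinset a \ A).card + (A.card - 1) := by
    have h₁ := Finset.card_sdiff_add_card_inter (G.neighborFinset a) A
    have h₂ : (G.neighborFinset a ∩ A).card ≤ (A.erase a).card := by
      refine Finset.card_le_card fun y hy => ?_
      simp only [Finset.mem_inter, SimpleGraph.mem_neighborFinset] at hy
      exact Finset.mem_erase.2 ⟨hy.1.ne', hy.2⟩
    rw [Finset.card_erase_of_mem ha] at h₂
    have := hd a
    rw [← SimpleGraph.card_neighborFinset_eq_degree] at this
    omega
  rw [hcard] at hpos hl
  have hA1 : 0 < A.card := Finset.card_pos.2 ⟨a, ha⟩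
  have hk1 := Nat.pos_of_mul_pos_left hpos
  generalize (G.neighborFinset a \ A).card = k at *
  generalize A.card = n at *
  obtain ⟨n, rfl⟩ : ∃ m, n = m + 1 := ⟨n - 1, by omega⟩
  obtain ⟨k, rfl⟩ : ∃ m, k = m + 1 := ⟨k - 1, by omega⟩
  simp only [add_tsub_cancel_right] at hdeg
  -- With `A` of size `n + 1` and `k + 1` edges leaving from each vertex, `d ≤ n + k + 1 ≤ (n + 1) *
  -- (k + 1) ≤ l`.
  nlinarith

/-- If at least `d` edges leave each finite set with an odd number of vertices of a graph of
degree `d`, then each finite set of vertices is covered by a matching. -/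
theorem exists_matching_on {d : ℕ} (hd0 : 0 < d) (hd : ∀ x, G.degree x = d)
    (hcut : ∀ C : Finset V, Odd C.card → d ≤ (boundary G C).card) (S : Finset V) :
    ∃ m : V → V, ∀ x ∈ S, G.Adj x (m x) ∧ (m x ∈ S → m (m x) = x) := by
  -- Tutte's theorem is applied to a finite graph: `S` with its neighbours, a dummy vertex if needed
  -- to make the order even, and all edges added between vertices outside `S`. In a perfect matching
  -- of it, vertices of `S` are still matched along edges of `G`.
  let T : Finset V := S ∪ S.biUnion fun x => G.neighborFinset x
  have hST : ∀ x ∈ S, x ∈ T := fun x hx => Finset.mem_union_left _ hx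
  have hNT : ∀ x ∈ S, ∀ y, G.Adj x y → y ∈ T := fun x hx y hy =>
    Finset.mem_union_right _ (Finset.mem_biUnion.2 ⟨x, hx, by simpa using hy⟩)
  let W := T ⊕ Fin (T.card % 2)
  let val : W → Option V := Sum.elim (fun x => some x.1) fun _ => none
  have val_inj : ∀ a b x, val a = some x → val b = some x → a = b := by
    rintro (a | a) (b | b) x ha hb
    · simp only [val, Sum.elim_inl, Option.some.injEq] at ha hb
      exact congrArg _ (Subtype.ext (ha.trans hb.symm))
    all_goals simp [val] at ha hb
  have val_surj : ∀ x ∈ T, ∃ a, val a = some x := fun x hx => ⟨Sum.inl ⟨x, hx⟩, rfl⟩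
  let inS : W → Prop := fun a => ∃ x ∈ S, val a = some x
  let H : SimpleGraph W :=
    { Adj := fun a b => a ≠ b ∧ ((¬ inS a ∧ ¬ inS b) ∨
        ∃ x y, val a = some x ∧ val b = some y ∧ G.Adj x y)
      symm := ⟨by
        rintro a b ⟨hne, h | ⟨x, y, hx, hy, h⟩⟩
        · exact ⟨hne.symm, Or.inl h.symm⟩
        · exact ⟨hne.symm, Or.inr ⟨y, x, hy, hx, h.symm⟩⟩⟩
      loopless := ⟨fun a h => h.1 rfl⟩ }
  have H_adj : ∀ a b x y, val a = some x → val b = some y → G.Adj x y → H.Adj a b := by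
    rintro a b x y hx hy h
    refine ⟨?_, Or.inr ⟨x, y, hx, hy, h⟩⟩
    rintro rfl
    exact h.ne (Option.some.inj (hx.symm.trans hy))
  have hWeven : Even (Nat.card W) := by
    simp only [W, Nat.card_eq_fintype_card, Fintype.card_sum, Fintype.card_coe, Fintype.card_fin]
    rw [Nat.even_iff]
    omega
  obtain ⟨M, hM⟩ := (SimpleGraph.tutte (G := H)).2 (by
    intro u hu
    rw [SimpleGraph.IsTutteViolator] at hu
    set K := ((⊤ : H.Subgraph).deleteVerts u).coe with hK
    have hKadj : ∀ a b, H.Adj a.1 b.1 → K.connectedComponentMk a = K.connectedComponentMk b := by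
      intro a b h
      apply SimpleGraph.ConnectedComponent.sound
      apply SimpleGraph.Adj.reachable
      have ha := a.2
      have hb := b.2
      simp only [SimpleGraph.Subgraph.deleteVerts_verts, SimpleGraph.Subgraph.verts_top] at ha hb
      simp [hK, h, ha.2, hb.2]
    let I : Set K.ConnectedComponent := {c | c ∈ K.oddComponents ∧ ∀ w ∈ c.supp, inS w.1}
    -- The vertices outside `S` form a clique, so at most one component contains any of them.
    have hI : K.oddComponents.ncard ≤ I.ncard + 1 := by
      have h₁ : (K.oddComponents \ I).ncard ≤ 1 := by
        rw [Set.ncard_le_one_iff]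
        have : ∀ c ∈ K.oddComponents \ I, ∃ w ∈ c.supp, ¬ inS w.1 := by
          rintro c ⟨hc, hcI⟩
          by_contra! h
          exact hcI ⟨hc, h⟩
        intro c c' hc hc'
        obtain ⟨w, rfl, hw⟩ := this c hc
        obtain ⟨w', rfl, hw'⟩ := this c' hc'
        by_cases hww : w = w'
        · rw [hww]
        · exact hKadj w w' ⟨fun h => hww (Subtype.ext h), Or.inl ⟨hw, hw'⟩⟩
      have h₂ := Set.ncard_sdiff_add_ncard_of_subset (s := I) (t := K.oddComponents) fun c hc => hc.1
      omega
    -- As the total order is even, this parity rules out an excess of exactly one odd component over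
    -- `u`.
    have hpar : K.oddComponents.ncard % 2 = u.ncard % 2 := by
      have h₁ := K.odd_ncard_oddComponents
      have h₂ : Nat.card ((⊤ : H.Subgraph).deleteVerts u).verts + u.ncard = Nat.card W := by
        rw [Nat.card_coe_set_eq, SimpleGraph.Subgraph.deleteVerts_verts,
          SimpleGraph.Subgraph.verts_top, Set.ncard_sdiff_add_ncard_of_subset (Set.subset_univ u),
          Set.ncard_univ]
      rw [Nat.odd_iff, Nat.odd_iff] at h₁
      rw [Nat.even_iff] at hWeven
      omega
    let C : K.ConnectedComponent → Finset V := fun c =>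
      S.filter fun x => ∃ w ∈ c.supp, val w.1 = some x
    have hCodd : ∀ c ∈ I, Odd (C c).card := by
      rintro c ⟨hc, hcS⟩
      have : c.supp.ncard = (C c : Set V).ncard := by
        choose f hfS hf using hcS
        refine Set.ncard_congr (fun w hw => f w hw) (fun w hw => ?_) (fun w w' hw hw' h => ?_)
          fun x hx => ?_
        · simp only [C, Finset.coe_filter, Set.mem_ofPred_eq]
          exact ⟨hfS w hw, w, hw, hf w hw⟩
        · exact Subtype.ext (val_inj _ _ _ (hf w hw) (h ▸ hf w' hw'))
        · simp only [C, Finset.coe_filter, Set.mem_ofPred_eq] at hx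
          obtain ⟨hxS, w, hw, hwx⟩ := hx
          exact ⟨w, hw, Option.some.inj ((hf w hw).symm.trans hwx)⟩
      rw [Set.ncard_coe_finset] at this
      rw [← this]
      exact hc
    let U : Finset V := T.filter fun y => ∃ a ∈ u, val a = some y
    have hU : U.card ≤ u.ncard := by
      have hUu : ∀ y : U, ∃ a : u, val a = some y.1 := fun y => by
        obtain ⟨a, ha, h⟩ := (Finset.mem_filter.1 y.2).2
        exact ⟨⟨a, ha⟩, h⟩
      choose f hf using hUu
      have := Nat.card_le_card_of_injective f fun y z h =>
        Subtype.ext (Option.some.inj ((hf y).symm.trans (h ▸ hf z)))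
      rwa [Nat.card_coe_set_eq, Nat.card_eq_fintype_card, Fintype.card_coe] at this
    -- All `G`-neighbours of `S` are present in `H`, so an edge leaving a component can only end in
    -- the deleted set.
    have hcomp : ∀ c ∈ I, ∀ a ∈ boundary G (C c), a.2 ∈ U := by
      rintro c hc ⟨x, y⟩ ha
      obtain ⟨hx, hy, hxy⟩ := mem_boundary.1 ha
      obtain ⟨hxS, w, rfl, hwx⟩ := Finset.mem_filter.1 hx
      obtain ⟨b, hb⟩ := val_surj y (hNT x hxS y hxy)
      refine Finset.mem_filter.2 ⟨hNT x hxS y hxy, b, ?_, hb⟩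
      by_contra hbu
      have hbv : b ∈ ((⊤ : H.Subgraph).deleteVerts u).verts := by simp [hbu]
      have hcb : K.connectedComponentMk ⟨b, hbv⟩ = K.connectedComponentMk w :=
        (hKadj w ⟨b, hbv⟩ (H_adj _ _ _ _ hwx hb hxy)).symm
      obtain ⟨z, hzS, hz⟩ := hc.2 ⟨b, hbv⟩ hcb
      obtain rfl : y = z := Option.some.inj (hb.symm.trans hz)
      exact hy (Finset.mem_filter.2 ⟨hzS, ⟨b, hbv⟩, hcb, hb⟩)
    have hfinI : I.Finite := Set.toFinite I
    -- Each component in `I` sends at least `d` arcs to `U`, and each vertex of `U` receives at most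
    -- `d`.
    have hsum : d * hfinI.toFinset.card ≤ d * U.card := by
      calc d * hfinI.toFinset.card ≤ ∑ c ∈ hfinI.toFinset, (boundary G (C c)).card := by
            rw [mul_comm, ← smul_eq_mul]
            exact Finset.card_nsmul_le_sum _ _ _ fun c hc =>
              hcut _ (hCodd c (hfinI.mem_toFinset.1 hc))
        _ = (hfinI.toFinset.biUnion fun c => boundary G (C c)).card := by
            rw [Finset.card_biUnion]
            intro c _ c' _ hne
            refine Finset.disjoint_left.2 fun a ha ha' => hne ?_
            obtain ⟨-, w, rfl, hw⟩ := Finset.mem_filter.1 (mem_boundary.1 ha).1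
            obtain ⟨-, w', rfl, hw'⟩ := Finset.mem_filter.1 (mem_boundary.1 ha').1
            rw [Subtype.ext (val_inj _ _ _ hw hw')]
        _ ≤ (U.sigma fun y => G.neighborFinset y).card := by
            refine Finset.card_le_card_of_injOn (fun a => ⟨a.2, a.1⟩) (fun a ha => ?_) ?_
            · obtain ⟨c, hc, ha⟩ := Finset.mem_biUnion.1 ha
              refine Finset.mem_coe.2 (Finset.mem_sigma.2 ⟨hcomp c (hfinI.mem_toFinset.1 hc) a ha, ?_⟩)
              simpa using (mem_boundary.1 ha).2.2.symm
            · rintro ⟨x, y⟩ _ ⟨x', y'⟩ _ h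
              simpa [and_comm] using h
        _ = d * U.card := by
            simp [Finset.card_sigma, hd, mul_comm]
    have h₁ := Nat.le_of_mul_le_mul_left hsum hd0
    rw [← Set.ncard_eq_toFinset_card I hfinI] at h₁
    omega)
  let N : V → V → Prop := fun x y => ∃ a b, val a = some x ∧ val b = some y ∧ M.Adj a b
  have hN : ∀ x ∈ S, ∃ y, G.Adj x y ∧ N x y := by
    intro x hx
    obtain ⟨a, ha⟩ := val_surj x (hST x hx)
    obtain ⟨b, hb, -⟩ := hM.1 (hM.2 a)
    rcases hb.adj_sub with ⟨-, ⟨h, -⟩ | ⟨x', y, hx', hy, hxy⟩⟩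
    · exact absurd ⟨x, hx, ha⟩ h
    · obtain rfl : x = x' := Option.some.inj (ha.symm.trans hx')
      exact ⟨y, hxy, a, b, ha, hy, hb⟩
  choose! m hm hmN using hN
  refine ⟨m, fun x hx => ⟨hm x hx, fun hmx => ?_⟩⟩
  obtain ⟨a, b, ha, hb, hab⟩ := hmN x hx
  obtain ⟨b', c, hb', hc, hbc⟩ := hmN (m x) hmx
  obtain rfl := val_inj _ _ _ hb hb'
  obtain rfl := (hM.1 (hM.2 b)).unique hbc hab.symm
  exact Option.some.inj (hc.symm.trans ha)

/-- A connected vertex-transitive locally finite graph with an infinite or even number of vertices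
has a perfect matching. -/
theorem exists_perfect_matching (hG : G.Connected) (ht : ∀ x y, ∃ σ : G ≃g G, σ x = y)
    (heven : ∀ C : Finset V, Odd C.card → ∃ x, x ∉ C) :
    ∃ m : V → V, ∀ x, G.Adj x (m x) ∧ m (m x) = x := by
  obtain ⟨o⟩ := hG.nonempty
  have hd : ∀ x, G.degree x = G.degree o := fun x => by
    obtain ⟨σ, rfl⟩ := ht o x
    exact σ.degree_eq o
  have hd0 : 0 < G.degree o := by
    obtain ⟨z, hz⟩ := heven {o} (by simp)
    have : Nontrivial V := ⟨z, o, by simpa using hz⟩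
    exact hG.preconnected.degree_pos_of_nontrivial o
  have key := exists_matching_on hd0 hd fun C hC =>
    le_card_boundary hG ht hd (Finset.card_pos.1 hC.pos) (heven C hC)
  have hnb : ∀ x, ∃ y, G.Adj x y := fun x => by
    rw [← hd x, G.degree_pos_iff_exists_adj] at hd0
    exact hd0
  choose m hm using key
  choose n hn using hnb
  have : ∀ x, Finite {y // G.Adj x y} := fun x => inferInstanceAs (Finite (G.neighborSet x))
  -- Compactness over the finite neighbour sets. The involution property at `x` concerns only `x`
  -- and its partner, so it is inherited from a finite matching containing both; the value `n x`
  -- outside `S` is a mere default.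
  obtain ⟨χ, hχ⟩ := Finset.rado_selection (α := V) (β := fun x => {y // G.Adj x y}) fun S x =>
    if h : x ∈ S then ⟨m S x, (hm S x h).1⟩ else ⟨n x, hn x⟩
  refine ⟨fun x => χ x, fun x => ⟨(χ x).2, ?_⟩⟩
  obtain ⟨S, hS, hSχ⟩ := hχ {x, (χ x).1}
  have hx : x ∈ S := hS (by simp)
  have hy : (χ x).1 ∈ S := hS (by simp)
  have h₁ : (χ x).1 = m S x := by
    rw [hSχ x (by simp), dif_pos hx]
  have h₂ : (χ (χ x).1).1 = m S (χ x).1 := by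
    rw [hSχ _ (by simp : (χ x).1 ∈ _), dif_pos hy]
  change (χ (χ x).1).1 = x
  rw [h₂, h₁]
  exact (hm S x hx).2 (h₁ ▸ hy)

end Matching

/-- A locally finite vertex-transitive graph in which each finite union of components has an even
number of vertices has a perfect matching. -/
theorem exists_perfect_matching_of_even_components {V : Type*} (H : SimpleGraph V)
    (hfin : ∀ x, {y | H.Adj x y}.Finite) (ht : ∀ x y, ∃ σ : H ≃g H, σ x = y)
    (heven : ∀ C : Finset V, (∀ x ∈ C, ∀ y, H.Adj x y → y ∈ C) → Even C.card) :
    ∃ m : V → V, ∀ x, H.Adj x (m x) ∧ m (m x) = x := by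
  classical
  have key : ∀ c : H.ConnectedComponent, ∃ m : V → V, ∀ x ∈ c.supp, H.Adj x (m x) ∧ m (m x) = x := by
    intro c
    let _ : c.toSimpleGraph.LocallyFinite := fun x => Set.Finite.fintype
      (Set.Finite.subset ((hfin x).preimage Subtype.val_injective.injOn) fun y hy => hy)
    obtain ⟨m, hm⟩ := exists_perfect_matching (G := c.toSimpleGraph) c.connected_toSimpleGraph (by
      rintro ⟨x, hx⟩ ⟨y, hy⟩
      obtain ⟨σ, rfl⟩ := ht x y
      -- An automorphism taking one vertex of a component to another preserves that component, so
      -- components are vertex transitive.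
      have hσ : ∀ z, z ∈ c ↔ σ z ∈ c := by
        intro z
        change H.connectedComponentMk x = c at hx
        change H.connectedComponentMk (σ x) = c at hy
        change H.connectedComponentMk z = c ↔ H.connectedComponentMk (σ z) = c
        have h₁ : H.connectedComponentMk z = c ↔ H.Reachable z x := by
          rw [← SimpleGraph.ConnectedComponent.eq, hx]
        have h₂ : H.connectedComponentMk (σ z) = c ↔ H.Reachable (σ z) (σ x) := by
          rw [← SimpleGraph.ConnectedComponent.eq, hy]
        rw [h₁, h₂]
        exact σ.reachable_iff.symm
      exact ⟨{ toEquiv := σ.toEquiv.subtypeEquiv hσ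
               map_rel_iff' := σ.map_adj_iff }, rfl⟩) (by
      intro C hC
      -- A set exhausting the component is closed under adjacency, hence even by `heven`.
      by_contra! hall
      refine Nat.not_even_iff_odd.2 hC ?_
      rw [← Finset.card_map (Function.Embedding.subtype _)]
      refine heven _ fun x hx y hxy => ?_
      simp only [Finset.mem_map, Function.Embedding.subtype_apply, Subtype.exists,
        exists_and_right, exists_eq_right] at hx ⊢
      obtain ⟨hx, -⟩ := hx
      exact ⟨c.mem_supp_of_adj_mem_supp hx hxy, hall _⟩)
    refine ⟨fun x => if h : x ∈ c then (m ⟨x, h⟩).1 else x, fun x hx => ?_⟩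
    have hx' : x ∈ c := hx
    simp only [dif_pos hx', (m ⟨x, hx'⟩).2, dite_true]
    exact ⟨(hm ⟨x, hx'⟩).1, congrArg Subtype.val (hm ⟨x, hx'⟩).2⟩
  choose m hm using key
  refine ⟨fun x => m (H.connectedComponentMk x) x, fun x => ?_⟩
  obtain ⟨h₁, h₂⟩ := hm (H.connectedComponentMk x) x rfl
  refine ⟨h₁, ?_⟩
  change m (H.connectedComponentMk (m (H.connectedComponentMk x) x)) _ = x
  rw [← SimpleGraph.ConnectedComponent.sound h₁.reachable]
  exact h₂

/-! ### Every countable vertex-transitive graph is colourable -/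

namespace MGraph

variable {G : MGraph.{u}}

/-- The matching serves as one additional self-inverse colour, `none`. -/
theorem colourable_of_matching (M : Set G.E) (hinv : ∀ e, G.inv e ∈ M ↔ e ∈ M)
    (hM : ∀ x, ∃! e, e ∈ M ∧ G.init e = x)
    (h : (G.edgeSub Mᶜ fun e he h => he ((hinv e).1 h)).Colourable) : G.Colourable := by
  classical
  obtain ⟨K, ι, col, hcol⟩ := h
  refine ⟨Option K, Option.map ι, fun e => if h : e ∈ M then none else some (col ⟨e, h⟩), ?_, ?_, ?_⟩
  · rintro (_ | k)
    · rfl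
    · simp [hcol.invol]
  · intro e
    by_cases h : e ∈ M
    · simp [h, hinv]
    · have h' : G.inv e ∉ M := fun h' => h ((hinv e).1 h')
      simp only [dif_neg h, dif_neg h', Option.map_some, Option.some.injEq]
      exact hcol.map_inv ⟨e, h⟩
  · rintro x (_ | k)
    · obtain ⟨e, ⟨he, hx⟩, hu⟩ := hM x
      refine ⟨e, ⟨hx, by simp [he]⟩, ?_⟩
      rintro e' ⟨hx', h'⟩
      exact hu e' ⟨by simpa using h', hx'⟩
    · obtain ⟨⟨e, he⟩, ⟨hx, hk⟩, hu⟩ := hcol.existsUnique x k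
      refine ⟨e, ⟨hx, ?_⟩, ?_⟩
      · rw [dif_neg he, hk]
      · rintro e' ⟨hx', h'⟩
        by_cases he' : e' ∈ M
        · simp [he'] at h'
        · rw [dif_neg he', Option.some.injEq] at h'
          exact congrArg Subtype.val (hu ⟨e', he'⟩ ⟨hx', h'⟩)

theorem encard_star_eq (hG : G.VertexTransitive) (x y : G.V) :
    {e | G.init e = x}.encard = {e | G.init e = y}.encard := by
  obtain ⟨f, rfl⟩ := hG x y
  rw [← f.bijective_onE.1.encard_image]
  congr 1
  ext e
  obtain ⟨e, rfl⟩ := f.bijective_onE.2 e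
  simp [f.bijective_onE.1.eq_iff, ← f.map_init, f.bijective_onV.1.eq_iff]

/-- In a graph of odd degree, each finite union of components has an even number of vertices. -/
theorem even_card_of_closed {k : ℕ} (hk : ∀ x, {e | G.init e = x}.encard = (2 * k + 1 : ℕ))
    (C : Finset G.V) (hC : ∀ e, G.init e ∈ C → G.term e ∈ C) : Even C.card := by
  classical
  have hfin : ∀ x, {e | G.init e = x}.Finite := fun x => Set.finite_of_encard_eq_coe (hk x)
  have hcard : ∀ x, (hfin x).toFinset.card = 2 * k + 1 := fun x => by
    have := hk x
    rw [(hfin x).encard_eq_coe_toFinset_card] at this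
    exact_mod_cast this
  let F : Finset G.E := C.biUnion fun x => (hfin x).toFinset
  have hF : F.card = C.card * (2 * k + 1) := by
    rw [Finset.card_biUnion]
    · simp [hcard]
    · intro x _ y _ hne
      refine Finset.disjoint_left.2 fun e he he' => hne ?_
      simp only [Set.Finite.mem_toFinset, Set.mem_ofPred_eq] at he he'
      exact he.symm.trans he'
  have hmem : ∀ e, e ∈ F ↔ G.init e ∈ C := fun e => by simp [F]
  -- Handshake argument: inversion is a fixed-point-free involution of the edges starting in `C`.
  have hFe : Even F.card := by
    rw [← ZMod.natCast_eq_zero_iff_even, Finset.cast_card]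
    refine Finset.sum_involution (fun e _ => G.inv e) (fun _ _ => by decide)
      (fun e _ _ => G.inv_ne e) (fun e he => ?_) fun e _ => G.inv_inv e
    rw [hmem] at he ⊢
    rw [G.init_inv]
    exact hC e he
  rw [hF, Nat.even_mul] at hFe
  exact hFe.resolve_right (by simp)

/-- A countable loopless vertex-transitive graph with finite multiplicities is colourable. -/
theorem colourable_of_finite_multiplicity [Countable G.V] (hG : G.VertexTransitive)
    (hloop : ∀ e, G.init e ≠ G.term e)
    (hfin : ∀ x y, {e | G.init e = x ∧ G.term e = y}.Finite) : G.Colourable := by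
  classical
  by_cases hstar : ∀ x, {e | G.init e = x}.Infinite
  · have : Countable G.E := by
      have h : (Set.univ : Set G.E) = ⋃ p : G.V × G.V, {e | G.init e = p.1 ∧ G.term e = p.2} := by
        ext e
        simp
      rw [← Set.countable_univ_iff, h]
      exact Set.countable_iUnion fun p => (hfin p.1 p.2).countable
    obtain ⟨col, hcol⟩ := exists_colouring_of_infinite hloop fun x hx => hstar x (by
      refine (hx.biUnion fun y _ => hfin x y).subset fun e he => ?_
      simp only [Set.mem_iUnion, Set.mem_ofPred_eq]
      exact ⟨G.term e, ⟨e, he, rfl⟩, he, rfl⟩)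
    exact hcol.colourable
  obtain ⟨o, ho⟩ := not_forall.1 hstar
  rw [Set.not_infinite] at ho
  have hn : ∀ x, {e | G.init e = x}.encard = (ho.toFinset.card : ℕ) := fun x => by
    rw [encard_star_eq hG x o, ho.encard_eq_coe_toFinset_card]
  obtain ⟨k, hk | hk⟩ := Nat.even_or_odd' ho.toFinset.card
  · exact G.colourable_of_even (k := k) fun x => by rw [hn, hk]
  rw [hk] at hn
  have hsfin : ∀ x, {e | G.init e = x}.Finite := fun x => Set.finite_of_encard_eq_coe (hn x)
  -- The matching is sought in the underlying simple graph, whose degree may be even; the parity of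
  -- its components comes from the odd degree of `G`, counted with multiplicity.
  obtain ⟨m, hm⟩ := exists_perfect_matching_of_even_components (G.simple hloop)
    (fun x => ((hsfin x).image G.term).subset fun y ⟨e, he, hy⟩ => ⟨e, he, hy⟩) (fun x y => by
      obtain ⟨f, hf⟩ := hG x y
      exact ⟨{ toEquiv := Equiv.ofBijective _ f.bijective_onV
               map_rel_iff' := simple_adj_map f _ _ }, hf⟩)
    (fun C hC => even_card_of_closed hn C fun e he => hC _ he _ ⟨e, rfl, rfl⟩)
  have hch : ∀ x, ∃ e, G.init e = x ∧ G.term e = m x := fun x => (hm x).1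
  choose ch hch₁ hch₂ using hch
  obtain ⟨r, hr⟩ := exists_injective_nat G.V
  -- Of the parallel edges joining a matched pair, the one chosen at the end of smaller `r`-value is
  -- used from both ends.
  let ε : G.V → G.E := fun x => if r x < r (m x) then ch x else G.inv (ch (m x))
  have hε₁ : ∀ x, G.init (ε x) = x := fun x => by
    simp only [ε]
    split_ifs
    · exact hch₁ x
    · rw [G.init_inv, hch₂, (hm x).2]
  have hε₂ : ∀ x, G.inv (ε x) = ε (m x) := fun x => by
    have hne : r x ≠ r (m x) := fun h => (hm x).1.ne (hr h)
    simp only [ε, (hm x).2]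
    rcases lt_or_gt_of_ne hne with h | h
    · rw [if_pos h, if_neg h.not_gt]
    · rw [if_pos h, if_neg h.not_gt, G.inv_inv]
  have hinv : ∀ e, e ∈ Set.range ε → G.inv e ∈ Set.range ε := by
    rintro _ ⟨x, rfl⟩
    exact ⟨_, (hε₂ x).symm⟩
  have huniq : ∀ x, ∃! e, e ∈ Set.range ε ∧ G.init e = x := fun x =>
    ⟨ε x, ⟨⟨x, rfl⟩, hε₁ x⟩, by rintro _ ⟨⟨y, rfl⟩, h⟩; rw [← h, hε₁]⟩
  refine colourable_of_matching (Set.range ε)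
    (fun e => ⟨fun h => G.inv_inv e ▸ hinv _ h, hinv e⟩) huniq (colourable_of_even _ (k := k) ?_)
  exact encard_subtype_fibre G.init (Set.range ε) hn huniq

/-- Pieces of an invariant partition may be disconnected but remain vertex transitive, which is all
that their colouring needs. -/
theorem VertexTransitive.edgeSub (hG : G.VertexTransitive) (S : Set G.E)
    (hS : ∀ e ∈ S, G.inv e ∈ S) (h : ∀ (f : Iso G G) (e : G.E), f.onE e ∈ S ↔ e ∈ S) :
    (G.edgeSub S hS).VertexTransitive := by
  intro x y
  obtain ⟨f, hf⟩ := hG x y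
  refine ⟨⟨⟨f.onV, fun e => ⟨f.onE e, (h f e).2 e.2⟩, fun e => Subtype.ext (f.map_inv e),
    fun e => f.map_term e⟩, f.bijective_onV, ?_, ?_⟩, hf⟩
  · intro e e' he
    exact Subtype.ext (f.bijective_onE.1 (congrArg Subtype.val he))
  · rintro ⟨e, he⟩
    obtain ⟨e, rfl⟩ := f.bijective_onE.2 e
    exact ⟨⟨e, (h f e).1 he⟩, rfl⟩

/-- The edges from `x` to `y`. -/
abbrev Between (G : MGraph.{u}) (x y : G.V) : Type u := {e // G.init e = x ∧ G.term e = y}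

/-- Inversion of edges. -/
def betweenInv (G : MGraph.{u}) (x y : G.V) : G.Between x y ≃ G.Between y x where
  toFun e := ⟨G.inv e, (G.init_inv e).trans e.2.2, e.2.1⟩
  invFun e := ⟨G.inv e, (G.init_inv e).trans e.2.2, e.2.1⟩
  left_inv e := Subtype.ext (G.inv_inv e)
  right_inv e := Subtype.ext (G.inv_inv e)

theorem Iso.nonempty_between_equiv (f : Iso G G) (x y : G.V) :
    Nonempty (G.Between x y ≃ G.Between (f.onV x) (f.onV y)) := by
  refine ⟨Equiv.ofBijective (fun e => ⟨f.onE e, ?_, ?_⟩) ⟨fun e e' h => ?_, ?_⟩⟩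
  · rw [← f.map_init, e.2.1]
  · rw [← f.map_term, e.2.2]
  · exact Subtype.ext (f.bijective_onE.1 (congrArg Subtype.val h))
  · rintro ⟨e, h₁, h₂⟩
    obtain ⟨e, rfl⟩ := f.bijective_onE.2 e
    rw [← f.map_init] at h₁
    rw [← f.map_term] at h₂
    exact ⟨⟨e, f.bijective_onV.1 h₁, f.bijective_onV.1 h₂⟩, rfl⟩

/-- Pairs of vertices joined by equal numbers of edges. -/
def multiplicitySetoid (G : MGraph.{u}) : Setoid (G.V × G.V) where
  r p q := Nonempty (G.Between p.1 p.2 ≃ G.Between q.1 q.2)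
  iseqv := ⟨fun _ => ⟨Equiv.refl _⟩, fun ⟨φ⟩ => ⟨φ.symm⟩, fun ⟨φ⟩ ⟨ψ⟩ => ⟨φ.trans ψ⟩⟩

/-- Every countable vertex-transitive graph is colourable. -/
theorem VertexTransitive.colourable [Countable G.V] [Nonempty G.V] (hG : G.VertexTransitive) :
    G.Colourable := by
  classical
  -- The classes: `none` for loops, `some none` for all finite multiplicities together, `some (some
  -- q)` for the infinite multiplicity `q`. Only the vertices are countable, so uncountable
  -- multiplicities can occur.
  let p : G.E → Option (Option (Quotient G.multiplicitySetoid)) := fun e =>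
    if G.init e = G.term e then none
    else if Finite (G.Between (G.init e) (G.term e)) then some none
    else some (some (Quotient.mk _ (G.init e, G.term e)))
  have hp_congr : ∀ e e', (G.init e = G.term e ↔ G.init e' = G.term e') →
      Nonempty (G.Between (G.init e) (G.term e) ≃ G.Between (G.init e') (G.term e')) →
      p e = p e' := by
    rintro e e' h₁ ⟨φ⟩
    have h₂ : (Quotient.mk G.multiplicitySetoid (G.init e, G.term e)) =
        Quotient.mk _ (G.init e', G.term e') := Quotient.sound ⟨φ⟩
    simp only [p, h₁, φ.finite_iff, h₂]
  have hp : ∀ e, p (G.inv e) = p e := fun e =>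
    hp_congr _ _ (by rw [G.init_inv, G.term_inv, eq_comm])
      ⟨by rw [G.init_inv, G.term_inv]; exact G.betweenInv _ _⟩
  have hpf : ∀ (f : Iso G G) e, p (f.onE e) = p e := fun f e => by
    refine (hp_congr _ _ ?_ ?_).symm
    · rw [← f.map_init, ← f.map_term, f.bijective_onV.1.eq_iff]
    · rw [← f.map_init, ← f.map_term]
      exact f.nonempty_between_equiv _ _
  refine G.colourable_of_partition p hp fun i => ?_
  have hvt : (G.edgeSub {e | p e = i} fun e he => (hp e).trans he).VertexTransitive :=
    hG.edgeSub _ _ fun f e => by simp only [Set.mem_ofPred_eq, hpf f e]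
  have hp_none : ∀ e, p e = none ↔ G.init e = G.term e := fun e => by
    simp only [p]
    split_ifs <;> simp_all
  have hp_some : ∀ e, p e = some none ↔
      G.init e ≠ G.term e ∧ Finite (G.Between (G.init e) (G.term e)) := fun e => by
    simp only [p]
    split_ifs <;> simp_all
  have hp_some_some : ∀ e q, p e = some (some q) ↔
      G.init e ≠ G.term e ∧ ¬ Finite (G.Between (G.init e) (G.term e)) ∧
        Quotient.mk G.multiplicitySetoid (G.init e, G.term e) = q := fun e q => by
    simp only [p]
    split_ifs <;> simp_all
  rcases i with _ | _ | q
  · exact colourable_of_loops hvt fun e => ((hp_none e).1 e.2).symm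
  · refine colourable_of_finite_multiplicity hvt (fun e => ((hp_some e).1 e.2).1) fun x y => ?_
    refine Set.Finite.of_finite_image (f := Subtype.val) ?_ Subtype.val_injective.injOn
    rcases Set.eq_empty_or_nonempty
      {e : {e | p e = some none} | G.init e = x ∧ G.term e = y} with h | ⟨e, rfl, rfl⟩
    · refine Set.Finite.subset Set.finite_empty ?_
      rintro _ ⟨e, he, rfl⟩
      exact (Set.notMem_empty e (h ▸ he)).elim
    · have := ((hp_some e).1 e.2).2
      refine (Set.finite_coe_iff.1 this).subset ?_
      rintro _ ⟨e', he', rfl⟩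
      exact he'
  · by_cases hne : ∃ e, p e = some (some q)
    · obtain ⟨e₀, he₀⟩ := hne
      obtain ⟨-, hinf, rfl⟩ := (hp_some_some _ _).1 he₀
      rw [not_finite_iff_infinite] at hinf
      refine colourable_of_infinite_multiplicity hvt (fun e => ((hp_some_some _ _).1 e.2).1)
        (G.Between (G.init e₀) (G.term e₀)) fun e => ?_
      obtain ⟨φ⟩ := Quotient.exact ((hp_some_some _ _).1 e.2).2.2
      -- Parallel edges belong to the same class, so the piece has the full multiplicity of `G`
      -- between the ends of `e`.
      refine ⟨Equiv.trans ⟨fun e' => ⟨e'.1, e'.2⟩, fun e' => ⟨⟨e'.1, ?_⟩, e'.2⟩,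
        fun e' => rfl, fun e' => rfl⟩ φ⟩
      refine (hp_congr _ _ ?_ ?_).trans e.2
      · rw [e'.2.1, e'.2.2]
      · rw [e'.2.1, e'.2.2]
        exact ⟨Equiv.refl _⟩
    -- A multiplicity carried by no edge yields a piece without edges, which needs no colours.
    · exact ⟨PEmpty, id, fun e => (hne ⟨e.1, e.2⟩).elim, fun _ => rfl,
        fun e => (hne ⟨e.1, e.2⟩).elim, fun _ k => k.elim⟩

end MGraph

/-! ### Reversal of walks -/

namespace MGraph

/-- The reverse of a walk. -/
def reverse (G : MGraph.{u}) (l : List G.E) : List G.E := (l.map G.inv).reverse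

theorem reverse_cons (G : MGraph.{u}) (e : G.E) (l : List G.E) :
    G.reverse (e :: l) = G.reverse l ++ [G.inv e] := by
  simp [reverse]

theorem reverse_isWalk_and_endpoint (G : MGraph.{u}) (x : G.V) (l : List G.E) (h : G.IsWalk x l) :
    G.IsWalk (G.endpoint x l) (G.reverse l) ∧ G.endpoint (G.endpoint x l) (G.reverse l) = x := by
  induction l generalizing x with
  | nil => exact ⟨trivial, rfl⟩
  | cons e l ih =>
    obtain ⟨rfl, h⟩ := h
    obtain ⟨h₁, h₂⟩ := ih _ h
    rw [reverse_cons, isWalk_append, endpoint_append]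
    simp only [endpoint]
    exact ⟨⟨h₁, by rw [h₂]; exact ⟨G.init_inv e, trivial⟩⟩, rfl⟩

theorem Hom.isWalk_map {G H : MGraph.{u}} (f : Hom G H) {x : G.V} {l : List G.E}
    (h : G.IsWalk x l) : H.IsWalk (f.onV x) (l.map f.onE) := by
  induction l generalizing x with
  | nil => trivial
  | cons e l ih =>
    obtain ⟨rfl, h⟩ := h
    exact ⟨(f.map_init e).symm, f.map_term e ▸ ih h⟩

theorem Hom.endpoint_map {G H : MGraph.{u}} (f : Hom G H) (x : G.V) (l : List G.E) :
    H.endpoint (f.onV x) (l.map f.onE) = f.onV (G.endpoint x l) := by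
  induction l generalizing x with
  | nil => rfl
  | cons e l ih =>
    change H.endpoint (H.term (f.onE e)) (l.map f.onE) = f.onV (G.endpoint (G.term e) l)
    rw [← f.map_term]
    exact ih _

theorem Iso.connected {G H : MGraph.{u}} (f : Iso G H) (hG : G.Connected) : H.Connected := by
  refine ⟨hG.1.map f.onV, fun x y => ?_⟩
  obtain ⟨x, rfl⟩ := f.bijective_onV.2 x
  obtain ⟨y, rfl⟩ := f.bijective_onV.2 y
  obtain ⟨l, hl, rfl⟩ := hG.2 x y
  exact ⟨_, f.isWalk_map hl, f.endpoint_map x l⟩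

/-- The composition of an isomorphism with the inverse of an isomorphism. -/
theorem Iso.nonempty_trans_symm {G H K : MGraph.{u}} (f : Iso G H) (g : Iso K H) :
    Nonempty (Iso G K) := by
  let v := Equiv.ofBijective _ g.bijective_onV
  let e := Equiv.ofBijective _ g.bijective_onE
  have hv : ∀ y, g.onV (v.symm y) = y := v.apply_symm_apply
  have he : ∀ y, g.onE (e.symm y) = y := e.apply_symm_apply
  refine ⟨⟨⟨fun x => v.symm (f.onV x), fun d => e.symm (f.onE d), fun d => ?_, fun d => ?_⟩,
    v.symm.bijective.comp f.bijective_onV, e.symm.bijective.comp f.bijective_onE⟩⟩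
  · apply g.bijective_onE.1
    rw [he, g.map_inv, he, f.map_inv]
  · apply g.bijective_onV.1
    rw [hv, g.map_term, he, f.map_term]

end MGraph

namespace TwoComplex

/-- The pairs are inserted from the inside of each other: once the tail of `M` and its reverse are
present, the pair for the first edge goes between them. The start `z` of `M` moves along in the
induction, so it is kept independent of `b`. -/
theorem homotopy_reverse (C : TwoComplex.{u}) (b : C.skeleton.V) (z : C.skeleton.V)
    (L M : List C.skeleton.E) (hL : C.skeleton.IsWalk b L) (hM : C.skeleton.IsWalk z M)
    (he : C.skeleton.endpoint b L = C.skeleton.endpoint z M)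
    (h : C.skeleton.IsWalk b (L ++ (C.skeleton.reverse M ++ M))) :
    C.homotopy b ⟨L, hL⟩ ⟨L ++ (C.skeleton.reverse M ++ M), h⟩ := by
  induction M generalizing z with
  | nil =>
    simp only [MGraph.reverse, List.map_nil, List.reverse_nil, List.append_nil]
    exact Relation.EqvGen.refl _
  | cons e M ih =>
    have hr := C.skeleton.reverse_isWalk_and_endpoint _ _ hM.2
    have he' : C.skeleton.endpoint b L = C.skeleton.endpoint (C.skeleton.term e) M := he
    rw [← he'] at hr
    have h' : C.skeleton.IsWalk b (L ++ (C.skeleton.reverse M ++ M)) := by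
      rw [MGraph.isWalk_append, MGraph.isWalk_append, hr.2]
      exact ⟨hL, hr.1, hM.2⟩
    refine Relation.EqvGen.trans _ _ _ (ih _ hM.2 he' h') (Relation.EqvGen.rel _ _ ?_)
    have := Step.backtrack (C := C) (x := b) (L ++ C.skeleton.reverse M) M (C.skeleton.inv e) (by
      rw [MGraph.endpoint_append, hr.2, C.skeleton.init_inv])
    rw [C.skeleton.inv_inv] at this
    simpa [MGraph.reverse_cons] using this

/-- If closed walks are null-homotopic, then walks with the same endpoints are homotopic. -/
theorem homotopy_of_endpoint_eq (C : TwoComplex.{u}) (b : C.skeleton.V)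
    (hnull : ∀ p : C.WalkFrom b, C.skeleton.endpoint b p.1 = b → C.homotopy b p ⟨[], trivial⟩)
    (p q : C.WalkFrom b) (h : C.skeleton.endpoint b p.1 = C.skeleton.endpoint b q.1) :
    C.homotopy b p q := by
  have hr := C.skeleton.reverse_isWalk_and_endpoint _ _ q.2
  rw [← h] at hr
  have h₁ : C.skeleton.IsWalk b (p.1 ++ C.skeleton.reverse q.1) :=
    (MGraph.isWalk_append _ _ _ _).2 ⟨p.2, hr.1⟩
  have h₂ : C.skeleton.endpoint b (p.1 ++ C.skeleton.reverse q.1) = b := by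
    rw [MGraph.endpoint_append, hr.2]
  have h₃ : C.skeleton.IsWalk b (p.1 ++ C.skeleton.reverse q.1 ++ q.1) :=
    (MGraph.isWalk_append _ _ _ _).2 ⟨h₁, h₂.symm ▸ q.2⟩
  -- With `q'` the reverse of `q`, the walk `p` is homotopic to `p q' q`, and `p q'` is closed, so
  -- this is homotopic to `q`.
  have h₄ := C.homotopy_append (hnull ⟨_, h₁⟩ h₂) q.1 h₃ q.2
  have h₅ := C.homotopy_reverse b b p.1 q.1 p.2 q.2 h (by rwa [← List.append_assoc])
  simp only [← List.append_assoc] at h₅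
  exact Relation.EqvGen.trans _ _ _ h₅ h₄

/-- If closed walks at `b` are null-homotopic, then the universal cover is trivial. -/
theorem nonempty_iso_of_null (C : TwoComplex.{u}) (b : C.skeleton.V) (hC : C.skeleton.Connected)
    (hnull : ∀ p : C.WalkFrom b, C.skeleton.endpoint b p.1 = b → C.homotopy b p ⟨[], trivial⟩) :
    Nonempty (MGraph.Iso (C.universalCover b).skeleton C.skeleton) := by
  have hV : Function.Bijective (C.projV b) := by
    refine ⟨fun v w => ?_, (C.universalCoverProj_isCovering b hC).surjective⟩
    induction v using Quotient.inductionOn with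
    | _ p =>
      induction w using Quotient.inductionOn with
      | _ q => exact fun h => Quotient.sound (C.homotopy_of_endpoint_eq b hnull p q h)
  refine ⟨⟨(C.universalCoverProj b).toHom, hV, ?_, ?_⟩⟩
  · rintro ⟨⟨v, e⟩, h⟩ ⟨⟨v', e'⟩, h'⟩ he
    obtain rfl : e = e' := he
    obtain rfl : v = v' := hV.1 (Eq.trans (Eq.symm h) h')
    rfl
  · intro e
    obtain ⟨v, hv⟩ := hV.2 (C.skeleton.init e)
    exact ⟨⟨(v, e), hv.symm⟩, rfl⟩

end TwoComplex

/-! ### Null-homotopy when the relators are the full stabilizers -/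

namespace PartitePresentation

theorem walk_append (P : PartitePresentation.{u}) (x : P.X) (v w : List (Letter P.U P.I)) :
    P.walk x (v ++ w) = P.walk x v ++ P.walk (P.graph.endpoint x (P.walk x v)) w := by
  induction v generalizing x with
  | nil => rfl
  | cons s v ih => exact congrArg ((x, s) :: ·) (ih _)

theorem eq_walk (P : PartitePresentation.{u}) (x : P.X) (L : List P.graph.E)
    (hL : P.graph.IsWalk x L) : L = P.walk x (L.map Prod.snd) := by
  induction L generalizing x with
  | nil => rfl
  | cons e L ih =>
    obtain ⟨y, s⟩ := e
    obtain ⟨h, hL⟩ := hL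
    have hy : y = x := (P.perm_inv s y).symm.trans h
    subst hy
    exact congrArg ((y, s) :: ·) (ih _ hL)

/-- Each walk in the presentation graph is homotopic to the walk dictated by a reduced word. -/
theorem exists_reduced (P : PartitePresentation.{u}) (x : P.X) (w : List (Letter P.U P.I)) :
    ∃ v, Letter.Reduced v ∧ P.complex.homotopy x ⟨P.walk x w, P.isWalk_walk x w⟩
      ⟨P.walk x v, P.isWalk_walk x v⟩ := by
  induction w using List.reverseRecOn with
  | nil => exact ⟨[], List.isChain_nil, Relation.EqvGen.refl _⟩
  | append_singleton w s ih =>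
    obtain ⟨v, hv, h⟩ := ih
    have hend : P.graph.endpoint x (P.walk x w) = P.graph.endpoint x (P.walk x v) :=
      congrArg (P.complex.projV x) (Quotient.sound (s := P.complex.homotopy x) h)
    have h₁ : P.complex.homotopy x ⟨P.walk x (w ++ [s]), P.isWalk_walk x _⟩
        ⟨P.walk x (v ++ [s]), P.isWalk_walk x _⟩ := by
      have hw := P.isWalk_walk x (w ++ [s])
      have hv := P.isWalk_walk x (v ++ [s])
      have e₁ := P.walk_append x w [s]
      have e₂ := P.walk_append x v [s]
      rw [hend] at e₁
      simp only [e₁, e₂] at hw hv ⊢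
      exact P.complex.homotopy_append h _ hw hv
    by_cases hred : Letter.Reduced (v ++ [s])
    · exact ⟨_, hred, h₁⟩
    -- As `v` is reduced, appending `s` can fail only by cancelling the last letter of `v`; that
    -- backtrack is then removed.
    · obtain ⟨v', t, rfl, rfl⟩ : ∃ v' t, v = v' ++ [t] ∧ s = t.inv := by
        induction v using List.reverseRecOn with
        | nil => exact absurd (List.isChain_singleton s) hred
        | append_singleton v' t _ =>
          refine ⟨v', t, rfl, ?_⟩
          by_contra hne
          refine hred (List.isChain_append.2 ⟨hv, List.isChain_singleton s, ?_⟩)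
          simpa using hne
      refine ⟨v', (List.isChain_append.1 hv).1, Relation.EqvGen.trans _ _ _ h₁
        (Relation.EqvGen.symm _ _ (Relation.EqvGen.rel _ _ ?_))⟩
      have := TwoComplex.Step.backtrack (C := P.complex) (x := x) (P.walk x v') []
        (P.graph.endpoint x (P.walk x v'), t) (P.perm_inv t _)
      simpa [walk_append, walk, MGraph.endpoint_append] using this

/-- If the relator sets are the full stabilizers, then closed walks are null-homotopic. -/
theorem homotopy_nil (P : PartitePresentation.{u})
    (hR : ∀ x w, (action P.φ P.sq_eq_one w).unop x = x → w ∈ P.R x) (x : P.X)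
    (p : P.complex.WalkFrom x) (hp : P.graph.endpoint x p.1 = x) :
    P.complex.homotopy x p ⟨[], trivial⟩ := by
  obtain ⟨L, hL⟩ := p
  obtain ⟨w, rfl⟩ : ∃ w, L = P.walk x w := ⟨_, P.eq_walk x L hL⟩
  obtain ⟨v, hv, h⟩ := P.exists_reduced x w
  have hend : P.graph.endpoint x (P.walk x w) = P.graph.endpoint x (P.walk x v) :=
    congrArg (P.complex.projV x) (Quotient.sound (s := P.complex.homotopy x) h)
  refine Relation.EqvGen.trans _ _ _ h (Relation.EqvGen.symm _ _ (Relation.EqvGen.rel _ _ ?_))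
  -- The reduced word fixes `x`, hence is itself a relator and bounds a single 2-cell. Reduction
  -- comes first because cells are attached along reduced words only.
  have hmem : (v.map Letter.toMF).prod ∈ P.R x :=
    hR _ _ ((P.endpoint_walk x v).symm.trans (hend.symm.trans hp))
  have := TwoComplex.Step.cell (C := P.complex) (x := x) [] [] ⟨(x, v), hv, hmem⟩ rfl
  simpa using this

end PartitePresentation

/-! ### From colourings to partite presentations -/

/-- A set with an involution is the set of letters for some sets of generators. -/
theorem exists_letters {K : Type u} (ι : K → K) (hι : ∀ k, ι (ι k) = k) :
    ∃ (U I : Type u) (f : K → Letter U I), Function.Bijective f ∧ ∀ k, f (ι k) = (f k).inv := by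
  classical
  -- An arbitrary linear order picks the positive letter in each two-element orbit of `ι`.
  let _ : LinearOrder K := linearOrderOfSTO WellOrderingRel
  let g : Letter {k // k < ι k} {k // ι k = k} → K := fun l => match l with
    | .pos k => k
    | .neg k => ι k
    | .invol k => k
  have hg_inv : ∀ l, g l.inv = ι (g l) := by
    rintro (⟨k, hk⟩ | ⟨k, hk⟩ | ⟨k, hk⟩)
    · rfl
    · exact (hι k).symm
    · exact hk.symm
  have hg : Function.Bijective g := by
    constructor
    · rintro (⟨k, hk⟩ | ⟨k, hk⟩ | ⟨k, hk⟩) (⟨l, hl⟩ | ⟨l, hl⟩ | ⟨l, hl⟩) h <;> simp only [g] at h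
      · subst h; rfl
      · subst h; rw [hι] at hk; exact (lt_asymm hk hl).elim
      · subst h; exact (hk.ne' hl).elim
      · subst h; rw [hι] at hl; exact (lt_asymm hk hl).elim
      · have := congrArg ι h
        rw [hι, hι] at this
        subst this; rfl
      · subst h; rw [hι] at hl; exact (hk.ne hl).elim
      · subst h; exact (hl.ne' hk).elim
      · subst h; rw [hι] at hk; exact (hl.ne hk).elim
      · subst h; rfl
    · intro k
      rcases lt_trichotomy k (ι k) with h | h | h
      · exact ⟨.pos ⟨k, h⟩, rfl⟩
      · exact ⟨.invol ⟨k, h.symm⟩, rfl⟩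
      · exact ⟨.neg ⟨ι k, by rwa [hι]⟩, hι k⟩
  let φ := Equiv.ofBijective g hg
  refine ⟨_, _, φ.symm, φ.symm.bijective, fun k => ?_⟩
  rw [Equiv.symm_apply_eq]
  refine Eq.trans ?_ (hg_inv _).symm
  exact congrArg ι (φ.apply_symm_apply k).symm

theorem Letter.inv_inv {U I : Type u} (l : Letter U I) : l.inv.inv = l := by
  cases l <;> rfl

namespace MGraph

/-- A connected colourable graph is the presentation graph of a partite presentation in which all
closed walks are relators. -/
theorem Colourable.exists_presentation {G : MGraph.{u}} (h : G.Colourable) (hG : G.Connected) :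
    ∃ P : PartitePresentation.{u}, Nonempty (Iso G P.graph) ∧
      ∀ x w, (action P.φ P.sq_eq_one w).unop x = x → w ∈ P.R x := by
  obtain ⟨K, ι, col, hcol⟩ := h
  obtain ⟨U, I, f, hf, hfι⟩ := exists_letters ι hcol.invol
  let c : G.E → Letter U I := fun e => f (col e)
  have hc_inv : ∀ e, c (G.inv e) = (c e).inv := fun e => by
    simp only [c, hcol.map_inv, hfι]
  have hc : ∀ x l, ∃! e, G.init e = x ∧ c e = l := fun x l => by
    obtain ⟨k, rfl⟩ := hf.2 l
    simpa only [c, hf.1.eq_iff] using hcol.existsUnique x k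
  choose ed hed hu using hc
  have hed₁ : ∀ x l, G.init (ed x l) = x := fun x l => (hed x l).1
  have hed₂ : ∀ x l, c (ed x l) = l := fun x l => (hed x l).2
  have hed_eq : ∀ e, ed (G.init e) (c e) = e := fun e => (hu _ _ e ⟨rfl, rfl⟩).symm
  -- Following `l` and then its inverse retraces the same edge, so each letter acts as a
  -- permutation.
  have hed_inv : ∀ x l, ed (G.term (ed x l)) l.inv = G.inv (ed x l) := fun x l => by
    have := hed_eq (G.inv (ed x l))
    rwa [G.init_inv, hc_inv, hed₂] at this
  have hleft : ∀ l x, G.term (ed (G.term (ed x l)) l.inv) = x := fun l x => by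
    rw [hed_inv]
    exact hed₁ x l
  let perm : Letter U I → Equiv.Perm G.V := fun l =>
    { toFun := fun x => G.term (ed x l)
      invFun := fun x => G.term (ed x l.inv)
      left_inv := hleft l
      right_inv := fun x => by
        have := hleft l.inv x
        rwa [l.inv_inv] at this }
  let φ : U ⊕ I → Equiv.Perm G.V := Sum.elim (fun s => perm (.pos s)) fun s => perm (.invol s)
  have hsq : ∀ i, φ (Sum.inr i) ^ 2 = 1 := fun i => by
    ext x
    exact hleft (.invol i) x
  have hact : ∀ l : Letter U I, (action φ hsq l.toMF).unop = perm l := by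
    rintro (s | s | s)
    · simp [action, Letter.toMF, φ]
    · simp only [action, Letter.toMF, map_inv, PresentedGroup.toGroup.of, MulOpposite.unop_inv,
        MulOpposite.unop_op]
      rfl
    · simp [action, Letter.toMF, φ]
  have hwalk : ∀ (l : List G.E) (x : G.V), G.IsWalk x l →
      (action φ hsq ((l.map c).map Letter.toMF).prod).unop x = G.endpoint x l := by
    intro l
    induction l with
    | nil => simp [endpoint]
    | cons e l ih =>
      rintro x ⟨rfl, hl⟩
      rw [List.map_cons, List.map_cons, List.prod_cons, map_mul, MulOpposite.unop_mul,
        Equiv.Perm.mul_apply, hact]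
      have : perm (c e) (G.init e) = G.term e := congrArg G.term (hed_eq e)
      rw [this, ih _ hl]
      rfl
  let P : PartitePresentation.{u} :=
    { X := G.V
      U := U
      I := I
      φ := φ
      nonempty := hG.1
      sq_eq_one := hsq
      -- At a fixed point, the edge of a self-inverse colour would be a loop equal to its own
      -- inverse.
      fixedPointFree := fun i x h => by
        have h' : G.term (ed x (.invol i)) = x := h
        have := hed_inv x (.invol i)
        rw [h'] at this
        exact G.inv_ne _ this.symm
      transitive := fun x y => by
        obtain ⟨l, hl, rfl⟩ := hG.2 x y
        exact ⟨_, hwalk l x hl⟩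
      R := fun x => {w | (action φ hsq w).unop x = x}
      stab := fun x r hr => hr }
  have hperm : ∀ l, P.perm l = perm l := by
    rintro (s | s | s) <;> rfl
  refine ⟨P, ⟨⟨⟨id, fun e => (G.init e, c e), fun e => ?_, fun e => ?_⟩, Function.bijective_id,
    fun e e' h => ?_, ?_⟩⟩, fun x w h => h⟩
  · refine Prod.ext ?_ (hc_inv e)
    change G.init (G.inv e) = P.perm (c e) (G.init e)
    rw [hperm, G.init_inv]
    exact (congrArg G.term (hed_eq e)).symm
  · change G.term e = P.perm (c e) (G.init e)
    rw [hperm]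
    exact (congrArg G.term (hed_eq e)).symm
  · rw [← hed_eq e, ← hed_eq e']
    exact congrArg₂ ed (congrArg Prod.fst h) (congrArg Prod.snd h)
  · rintro ⟨x, l⟩
    exact ⟨ed x l, Prod.ext (hed₁ x l) (hed₂ x l)⟩

end MGraph

end Partite

theorem theorem1p1 (Γ : Partite.MGraph.{u}) (hcount : Countable Γ.V) (hconn : Γ.Connected)
    (htrans : Γ.VertexTransitive) :
    ∃ P : Partite.PartitePresentation.{u}, ∀ b : P.X,
      Nonempty (Partite.MGraph.Iso Γ (P.cayleyGraph b)) := by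
  have := hconn.1
  obtain ⟨P, ⟨f⟩, hR⟩ := htrans.colourable.exists_presentation hconn
  refine ⟨P, fun b => ?_⟩
  obtain ⟨g⟩ := P.complex.nonempty_iso_of_null b (f.connected hconn) (P.homotopy_nil hR b)
  exact f.nonempty_trans_symm g
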